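/- Let $\mathbb{C}H^n=G/K$ be the complex hyperbolic space of constant holomorphic sectional curvature $-1$, with $G=SU(1,n)$ and $K=S(U(1)U(n))$ the isotropy group at $o\in\mathbb{C}H^n$, and let $\mathfrak g=\mathfrak{su}(1,n)=\mathfrak k\oplus\mathfrak p$ be the Cartan decomposition at $o$. Let $\mathfrak a\subset\mathfrak p$ be a maximal abelian (hence one-dimensional) subspace, spanned by a unit vector $B$ for the metric on $T_o\mathbb{C}H^n\cong\mathfrak p$, and let $\alpha$ be the restricted root with $\alpha(B)=\tfrac12$, so that $\mathfrak g_\alpha=\{Y\in\mathfrak g:[B,Y]=\tfrac12Y\}$ and $\mathfrak g_{2\alpha}=\{Y\in\mathfrak g:[B,Y]=Y\}$. Put $\mathfrak n=\mathfrak g_\alpha\oplus\mathfrak g_{2\alpha}$ and let $AN$ be the connected subgroup of $G$ with Lie algebra $\mathfrak a\oplus\mathfrak n$. It acts simply transitively on $\mathbb{C}H^n$; endow it with the left-invariant metric that makes $AN\to\mathbb{C}H^n$, $g\mapsto g\cdot o$, an isometry, and let $\langle\cdot,\cdot\rangle$ and $\lVert\cdot\rVert$ be the resulting inner product and norm on $\mathfrak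 a\oplus\mathfrak n$. Elements of $\mathfrak a\oplus\mathfrak n$ are regarded as left-invariant vector fields on $AN\cong\mathbb{C}H^n$. The mean curvature vector $\mathcal H$ of a submanifold is the trace of its second fundamental form (not divided by the dimension). Let $\mathfrak w$ be a real linear subspace of $\mathfrak g_\alpha$. (1) Let $a\in\mathbb R$, $a\neq0$, and let $X\in\mathfrak g_\alpha$, $X\neq0$, be orthogonal to $\mathfrak w$. Then $\mathfrak h=\mathbb R(aB+X)\oplus\mathfrak w\oplus\mathfrak g_{2\alpha}$ is a Lie subalgebra of $\mathfrak g$, and if $H$ is the connected Lie subgroup of $SU(1,n)$ with Lie algebra $\mathfrak h$, the mean curvature vector of the orbit $H\cdot o$ is \[ \mathcal H=\frac{3+\dim\mathfrak w}{2(a^2+\lVert X\rVert^2)}\bigl(\lVert X\rVert^2B-aX\bigr). \] (2) Let $\mathfrak b\in\{0,\mathfrak a\}$. Then $\mathfrak h=\mathfrak b\oplus\mathfrak w\oplus\mathfrak g_{2\alpha}$ is a Lie subalgebra of $\mathfrak g$, and if $H$ is the connected Lie subgroup of $SU(1,n)$ with Lie algebra $\mathfrak h$, the mean curvature vector of the orbit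 $H\cdot o$ is \[ \mathcal H=\begin{cases}0,&\text{if }\mathfrak b=\mathfrak a,\\ \tfrac12(2+\dim\mathfrak w)\,B,&\text{if }\mathfrak b=0.\end{cases} \] -/

import Mathlib

open scoped ContDiff Matrix

attribute [local instance 100] LieRing.ofAssociativeRing

noncomputable section

namespace ComplexHyperbolic

section Riemannian

/-! Submanifold geometry in an open subset of a real normed space `E` carrying a Riemannian
metric `g`, where `g p u v` is the inner product at `p` of the tangent vectors `u` and `v`. -/

variable {E : Type*} [NormedAddCommGroup E] [NormedSpace ℝ E]

/-- The Christoffel symbols of the first kind of the Levi-Civita connection of `g`: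
`g (∇_u v, w)` at `p` for the constant vector fields `u`, `v`, `w`. -/
def christoffel (g : E → E → E → ℝ) (p u v w : E) : ℝ :=
  (fderiv ℝ (fun z => g z v w) p u + fderiv ℝ (fun z => g z u w) p v
    - fderiv ℝ (fun z => g z u v) p w) / 2

/-- For a map `f` into `E`, the number `g (∇_u (df v), ν)` at `t`. If `ν` is normal to `f` at `t`
this is the second fundamental form of `f` in the direction `ν`, that is, the inner product of
`S_ν u` and `v` with `S_ν` the shape operator. -/
def secondFundamentalForm (g : E → E → E → ℝ) {k : ℕ} (f : (Fin k → ℝ) → E) (t : Fin k → ℝ)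
    (ν : E) (u v : Fin k → ℝ) : ℝ :=
  g (f t) (fderiv ℝ (fun s => fderiv ℝ f s) t u v) ν
    + christoffel g (f t) (fderiv ℝ f t u) (fderiv ℝ f t v) ν

/-- `η` is the mean curvature vector at `t` of the immersion `f`: it is normal to `f`, and its
inner product with any normal vector `ν` is the trace of the shape operator `S_ν`, computed in a
basis `e` that is orthonormal for the induced metric. -/
structure HasMeanCurvatureVector (g : E → E → E → ℝ) {k : ℕ} (f : (Fin k → ℝ) → E)
    (t : Fin k → ℝ) (η : E) : Prop where
  smooth : ContDiffAt ℝ ∞ f t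
  immersion : Function.Injective (fderiv ℝ f t)
  normal : ∀ u, g (f t) η (fderiv ℝ f t u) = 0
  trace : ∃ e : Fin k → (Fin k → ℝ),
    (∀ i j, g (f t) (fderiv ℝ f t (e i)) (fderiv ℝ f t (e j)) = if i = j then 1 else 0) ∧
    ∀ ν, (∀ u, g (f t) ν (fderiv ℝ f t u) = 0) →
      g (f t) η ν = ∑ i, secondFundamentalForm g f t ν (e i) (e i)

end Riemannian

/-- The metric of constant holomorphic sectional curvature `-1` on the unit ball of `ℂⁿ`, which is
the ball model of `ℂHⁿ`. -/
def metric {n : ℕ} (z u v : EuclideanSpace ℂ (Fin n)) : ℝ :=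
  4 * (inner ℂ u v / (1 - (‖z‖ : ℂ) ^ 2)
    + inner ℂ u z * inner ℂ z v / (1 - (‖z‖ : ℂ) ^ 2) ^ 2).re

/-- The matrix of the Hermitian form of signature `(1, n)`. -/
def form (n : ℕ) : Matrix (Fin (n + 1)) (Fin (n + 1)) ℂ :=
  Matrix.diagonal (Fin.cons (-1) fun _ => 1)

/-- The group `SU(1,n)`. -/
def SU (n : ℕ) : Subgroup (Matrix.SpecialLinearGroup (Fin (n + 1)) ℂ) where
  carrier := {g | (g : Matrix (Fin (n + 1)) (Fin (n + 1)) ℂ)ᴴ * form n * g.1 = form n}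
  one_mem' := by simp
  mul_mem' := by
    intro a b ha hb
    simp only [Set.mem_ofPred_eq, Matrix.SpecialLinearGroup.coe_mul,
      Matrix.conjTranspose_mul] at *
    calc b.1ᴴ * a.1ᴴ * form n * (a.1 * b.1)
        = b.1ᴴ * (a.1ᴴ * form n * a.1) * b.1 := by simp only [Matrix.mul_assoc]
      _ = form n := by rw [ha, hb]
  inv_mem' := by
    intro a ha
    simp only [Set.mem_ofPred_eq] at *
    have h : a.1 * (a⁻¹).1 = 1 := by
      rw [← Matrix.SpecialLinearGroup.coe_mul, mul_inv_cancel, Matrix.SpecialLinearGroup.coe_one]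
    have h' : (a⁻¹).1ᴴ * a.1ᴴ = 1 := by
      rw [← Matrix.conjTranspose_mul, h, Matrix.conjTranspose_one]
    calc (a⁻¹).1ᴴ * form n * (a⁻¹).1
        = (a⁻¹).1ᴴ * (a.1ᴴ * form n * a.1) * (a⁻¹).1 := by rw [ha]
      _ = ((a⁻¹).1ᴴ * a.1ᴴ) * form n * (a.1 * (a⁻¹).1) := by simp only [Matrix.mul_assoc]
      _ = form n := by rw [h, h', Matrix.one_mul, Matrix.mul_one]

/-- The real Lie algebra `su(1,n)`. -/
def su (n : ℕ) : LieSubalgebra ℝ (Matrix (Fin (n + 1)) (Fin (n + 1)) ℂ) where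
  carrier := {A | Aᴴ * form n + form n * A = 0 ∧ A.trace = 0}
  zero_mem' := by simp
  add_mem' := by
    rintro A C ⟨hA, hA'⟩ ⟨hC, hC'⟩
    refine ⟨?_, by simp [hA', hC']⟩
    calc (A + C)ᴴ * form n + form n * (A + C)
        = (Aᴴ * form n + form n * A) + (Cᴴ * form n + form n * C) := by
          rw [Matrix.conjTranspose_add]; noncomm_ring
      _ = 0 := by rw [hA, hC, add_zero]
  smul_mem' := by
    rintro c A ⟨hA, hA'⟩
    refine ⟨?_, by simp [hA']⟩
    rw [Matrix.conjTranspose_smul, star_trivial, Matrix.smul_mul, Matrix.mul_smul, ← smul_add,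
      hA, smul_zero]
  lie_mem' := by
    rintro A C ⟨hA, -⟩ ⟨hC, -⟩
    have hA1 : Aᴴ * form n = -(form n * A) := eq_neg_of_add_eq_zero_left hA
    have hC1 : Cᴴ * form n = -(form n * C) := eq_neg_of_add_eq_zero_left hC
    refine ⟨?_, by rw [Ring.lie_def, Matrix.trace_sub, Matrix.trace_mul_comm, sub_self]⟩
    rw [Ring.lie_def, Matrix.conjTranspose_sub, Matrix.conjTranspose_mul,
      Matrix.conjTranspose_mul, sub_mul, Matrix.mul_assoc, Matrix.mul_assoc, hA1, hC1,
      Matrix.mul_neg, Matrix.mul_neg, ← Matrix.mul_assoc, ← Matrix.mul_assoc, hA1, hC1]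
    noncomm_ring

/-- The action on the ball by fractional linear maps: `z` is the negative line spanned by
`(1, z)`. -/
def act {n : ℕ} (A : Matrix (Fin (n + 1)) (Fin (n + 1)) ℂ) (z : EuclideanSpace ℂ (Fin n)) :
    EuclideanSpace ℂ (Fin n) :=
  WithLp.toLp 2 fun i =>
    (A *ᵥ Fin.cons 1 fun j => z j) i.succ / (A *ᵥ Fin.cons 1 fun j => z j) 0

/-- The base point `o`, whose isotropy group is `S(U(1)U(n))`. -/
def basePoint (n : ℕ) : EuclideanSpace ℂ (Fin n) := 0

/-- The tangent vector at `g · o` that is the image under the differential of `g` of the tangent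
vector of `s ↦ exp(sY) · o` at `s = 0`. If `g` and `Y` belong to `AN` and its Lie algebra, this is
the value at `g · o` of the left-invariant vector field `Y`, for `AN` identified with `ℂHⁿ` through
`g ↦ g · o`. -/
def leftInvariantVector {n : ℕ} (g : SU n) (Y : su n) : EuclideanSpace ℂ (Fin n) :=
  deriv (fun s : ℝ => act (g.1.1 * NormedSpace.exp (s • Y.1)) (basePoint n)) 0

/-- On the Lie algebra of `AN`, the inner product that makes `g ↦ g · o` an isometry. -/
def innerAN {n : ℕ} (Y Y' : su n) : ℝ :=
  metric (basePoint n) (leftInvariantVector 1 Y) (leftInvariantVector 1 Y')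

/-- The `(-1)`-eigenspace `𝔭` of the Cartan involution `θ A = -Aᴴ` at `o`. -/
def cartanP (n : ℕ) : Submodule ℝ (su n) where
  carrier := {A | A.1ᴴ = A.1}
  zero_mem' := by simp
  add_mem' := by
    intro A C hA hC
    simp only [Set.mem_ofPred_eq] at *
    simp [hA, hC]
  smul_mem' := by
    intro c A hA
    simp only [Set.mem_ofPred_eq] at *
    simp [hA]

/-- The restricted root space `{A : [B, A] = c A}` of `𝔞 = ℝB`, for the functional on `𝔞` with
value `c` at `B`. -/
def rootSpace {n : ℕ} (B : su n) (c : ℝ) : Submodule ℝ (su n) :=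
  (LieAlgebra.ad ℝ (su n) B).eigenspace c

/-- The connected Lie subgroup of `SU(1,n)` with Lie algebra `𝔥`: the subgroup generated by the
exponentials of the elements of `𝔥`. -/
def connectedSubgroup {n : ℕ} (𝔥 : LieSubalgebra ℝ (su n)) : Subgroup (SU n) :=
  Subgroup.closure {g | ∃ A ∈ 𝔥, g.1.1 = NormedSpace.exp (A : su n).1}

/-- The orbit map `H → ℂHⁿ`, `h ↦ h · o`, in the exponential chart of the Lie group `H` at `g`
that is given by the basis `v` of its Lie algebra. -/
def orbitMap {n k : ℕ} {𝔥 : LieSubalgebra ℝ (su n)} (v : Module.Basis (Fin k) ℝ 𝔥) (g : SU n)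
    (t : Fin k → ℝ) : EuclideanSpace ℂ (Fin n) :=
  act (g.1.1 * NormedSpace.exp (∑ i, t i • (v i).1.1)) (basePoint n)

/-- The mean curvature vector field of the orbit through `o` of the connected Lie subgroup `H` with
Lie algebra `𝔥` is given by the left-invariant vector field `Y`. The orbit is the immersed
submanifold parametrized by the orbit map of the Lie group `H`. -/
def OrbitHasMeanCurvature {n : ℕ} (𝔥 : LieSubalgebra ℝ (su n)) (Y : su n) : Prop :=
  ∀ g ∈ connectedSubgroup 𝔥, ∀ (k : ℕ) (v : Module.Basis (Fin k) ℝ 𝔥),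
    HasMeanCurvatureVector metric (orbitMap v g) 0 (leftInvariantVector g Y)

end ComplexHyperbolic

end

noncomputable section

open Filter Topology

/-! `SU n` acts on the ball by isometries, and near any `g` in `H` the orbit is the image under `g`
of its germ at `o`. As left-invariant vectors are carried along in the same way, everything reduces
to `o` (`HasMeanCurvatureVector.act_comp`, `orbitHasMeanCurvature_of_orthonormal`).

At `o` the metric coefficients are even in `z`, so the Christoffel symbols vanish
(`christoffel_metric_zero`). Hence the second fundamental form on the direction of `A` is the normal
part of the Euclidean second derivative of `s ↦ exp(sA) · o`, an explicit quadratic expression in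
the matrix `A`. The mean curvature is the sum of these over an orthonormal basis of the Lie algebra.

Write `b` for the tangent vector of `B`. Solving `[B, A] = cA` blockwise gives `g_{2α} = ℝZ` with
`Z` tangent to `ib`, and tangent vectors of `g_α` complex-orthogonal to `b`. The accelerations are
then `b` for `Z`, `b/2` for a unit vector of `g_α`, and `(‖X‖² b - a X)/2` for `aB + X`
(`acceleration_one`, `acceleration_half`). For `ν` normal to `aB + X` one has `⟨X, ν⟩ = -a⟨B, ν⟩`,
so the normalized `aB + X` also contributes `⟨B, ν⟩/2`. The total is `(3 + dim w)/2` times the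
normal projection of `B`, which is `(‖X‖² B - aX)/(a² + ‖X‖²)`; without the `aB + X` direction it is
`(2 + dim w)/2` times `B`, already normal. -/

namespace ComplexHyperbolic

/-! ### Invariance of the second fundamental form and the mean curvature under isometries. -/

section Naturality

variable {E : Type*} [NormedAddCommGroup E] [NormedSpace ℝ E]

/-- The derivative of a metric that is preserved by `φ`, in terms of its derivative at the image
point. -/
theorem fderiv_metric_of_isometry {G : E → E →L[ℝ] E →L[ℝ] ℝ} {φ : E → E} {p : E}
    (hφ : ContDiffAt ℝ ∞ φ p) (hG : DifferentiableAt ℝ G (φ p))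
    (hiso : ∀ᶠ z in 𝓝 p, ∀ u v, G (φ z) (fderiv ℝ φ z u) (fderiv ℝ φ z v) = G z u v)
    (u v w : E) :
    fderiv ℝ (fun z => G z u v) p w =
      fderiv ℝ (fun z => G z (fderiv ℝ φ p u) (fderiv ℝ φ p v)) (φ p) (fderiv ℝ φ p w)
      + G (φ p) (fderiv ℝ (fun z => fderiv ℝ φ z) p w u) (fderiv ℝ φ p v)
      + G (φ p) (fderiv ℝ φ p u) (fderiv ℝ (fun z => fderiv ℝ φ z) p w v) := by
  have hφ1 : HasFDerivAt φ (fderiv ℝ φ p) p :=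
    (hφ.differentiableAt (by simp)).hasFDerivAt
  have hφ2 : HasFDerivAt (fun z => fderiv ℝ φ z) (fderiv ℝ (fun z => fderiv ℝ φ z) p) p :=
    ((hφ.fderiv_right (m := 1) (by norm_cast)).differentiableAt
      (by simp)).hasFDerivAt
  have h1 : fderiv ℝ (fun z => G z u v) p =
      fderiv ℝ (fun z => G (φ z) (fderiv ℝ φ z u) (fderiv ℝ φ z v)) p := by
    apply EventuallyEq.fderiv_eq
    filter_upwards [hiso] with z hz
    exact (hz u v).symm
  have hc : HasFDerivAt (fun z => G (φ z)) ((fderiv ℝ G (φ p)).comp (fderiv ℝ φ p)) p :=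
    HasFDerivAt.comp (g := G) p hG.hasFDerivAt hφ1
  have h2 := (hc.clm_apply (hφ2.clm_apply (hasFDerivAt_const u p))).clm_apply
    (hφ2.clm_apply (hasFDerivAt_const v p))
  have h3 := (hG.hasFDerivAt.clm_apply (hasFDerivAt_const (fderiv ℝ φ p u) (φ p))).clm_apply
    (hasFDerivAt_const (fderiv ℝ φ p v) (φ p))
  rw [h1, h2.fderiv, h3.fderiv]
  simp
  ring

/-- The transformation of the Christoffel symbols under an isometry. -/
theorem christoffel_of_isometry {G : E → E →L[ℝ] E →L[ℝ] ℝ} {φ : E → E} {p : E}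
    (hsymm : ∀ z u v, G z u v = G z v u)
    (hφ : ContDiffAt ℝ ∞ φ p) (hG : DifferentiableAt ℝ G (φ p))
    (hiso : ∀ᶠ z in 𝓝 p, ∀ u v, G (φ z) (fderiv ℝ φ z u) (fderiv ℝ φ z v) = G z u v)
    (u v w : E) :
    christoffel (fun z u v => G z u v) p u v w =
      christoffel (fun z u v => G z u v) (φ p) (fderiv ℝ φ p u) (fderiv ℝ φ p v) (fderiv ℝ φ p w)
      + G (φ p) (fderiv ℝ (fun z => fderiv ℝ φ z) p u v) (fderiv ℝ φ p w) := by
  have hs : IsSymmSndFDerivAt ℝ φ p := hφ.isSymmSndFDerivAt (by simpa using by norm_cast)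
  have hs' : ∀ x y, fderiv ℝ (fun z => fderiv ℝ φ z) p x y =
      fderiv ℝ (fun z => fderiv ℝ φ z) p y x := fun x y => hs.eq x y
  unfold christoffel
  -- The three metric derivatives produce six terms with second derivatives of `φ`; by symmetry of
  -- the second derivative four cancel and two equal ones remain, which the division by 2 merges.
  rw [fderiv_metric_of_isometry hφ hG hiso v w u, fderiv_metric_of_isometry hφ hG hiso u w v,
    fderiv_metric_of_isometry hφ hG hiso u v w, hs' w u, hs' w v, hs' v u,
    hsymm (φ p) (fderiv ℝ φ p v) (fderiv ℝ (fun z => fderiv ℝ φ z) p u w)]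
  ring

/-- The second derivative of `φ ∘ f` contains the extra term `D²φ(df u, df v)`, which is exactly the
inhomogeneous term in the transformation of the Christoffel symbols. -/
theorem secondFundamentalForm_isometry_comp {G : E → E →L[ℝ] E →L[ℝ] ℝ} {φ : E → E} {k : ℕ}
    {f : (Fin k → ℝ) → E} {t : Fin k → ℝ}
    (hsymm : ∀ z u v, G z u v = G z v u)
    (hφ : ContDiffAt ℝ ∞ φ (f t)) (hf : ContDiffAt ℝ ∞ f t)
    (hG : DifferentiableAt ℝ G (φ (f t)))
    (hiso : ∀ᶠ z in 𝓝 (f t), ∀ u v, G (φ z) (fderiv ℝ φ z u) (fderiv ℝ φ z v) = G z u v)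
    (ν : E) (u v : Fin k → ℝ) :
    secondFundamentalForm (fun z u v => G z u v) (fun s => φ (f s)) t (fderiv ℝ φ (f t) ν) u v =
      secondFundamentalForm (fun z u v => G z u v) f t ν u v := by
  have hφ1 : HasFDerivAt φ (fderiv ℝ φ (f t)) (f t) :=
    (hφ.differentiableAt (by simp)).hasFDerivAt
  have hf1 : HasFDerivAt f (fderiv ℝ f t) t := (hf.differentiableAt (by simp)).hasFDerivAt
  have hφ2 : HasFDerivAt (fun z => fderiv ℝ φ z) (fderiv ℝ (fun z => fderiv ℝ φ z) (f t)) (f t) :=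
    ((hφ.fderiv_right (m := 1) (by norm_cast)).differentiableAt
      (by simp)).hasFDerivAt
  have hf2 : HasFDerivAt (fun z => fderiv ℝ f z) (fderiv ℝ (fun z => fderiv ℝ f z) t) t :=
    ((hf.fderiv_right (m := 1) (by norm_cast)).differentiableAt
      (by simp)).hasFDerivAt
  have hev : (fun s => fderiv ℝ (fun r => φ (f r)) s) =ᶠ[𝓝 t]
      fun s => (fderiv ℝ φ (f s)).comp (fderiv ℝ f s) := by
    have h1 := (hφ.of_le (m := 1) (by norm_cast)).eventually (by simp)
    have h2 := (hf.of_le (m := 1) (by norm_cast)).eventually (by simp)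
    filter_upwards [hf.continuousAt.eventually h1, h2] with s hs1 hs2
    exact fderiv_comp s (hs1.differentiableAt (by simp)) (hs2.differentiableAt (by simp))
  have hd : fderiv ℝ (fun s => fderiv ℝ (fun r => φ (f r)) s) t u v =
      fderiv ℝ (fun z => fderiv ℝ φ z) (f t) (fderiv ℝ f t u) (fderiv ℝ f t v)
      + fderiv ℝ φ (f t) (fderiv ℝ (fun z => fderiv ℝ f z) t u v) := by
    have hc : HasFDerivAt (fun s => fderiv ℝ φ (f s))
        ((fderiv ℝ (fun z => fderiv ℝ φ z) (f t)).comp (fderiv ℝ f t)) t := hφ2.comp t hf1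
    rw [hev.fderiv_eq, (hc.clm_comp hf2).fderiv]
    simp [add_comm]
  have h0 : fderiv ℝ (fun r => φ (f r)) t = (fderiv ℝ φ (f t)).comp (fderiv ℝ f t) :=
    hev.self_of_nhds
  unfold secondFundamentalForm
  rw [hd, h0, christoffel_of_isometry hsymm hφ hG hiso]
  simp only [ContinuousLinearMap.comp_apply, map_add, add_apply]
  rw [hiso.self_of_nhds]
  ring

/-- Mean curvature vectors are preserved by isometries. -/
theorem HasMeanCurvatureVector.isometry_comp {G : E → E →L[ℝ] E →L[ℝ] ℝ} {φ : E → E} {k : ℕ}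
    {f : (Fin k → ℝ) → E} {t : Fin k → ℝ} {η : E}
    (h : HasMeanCurvatureVector (fun z u v => G z u v) f t η)
    (hsymm : ∀ z u v, G z u v = G z v u)
    (hφ : ContDiffAt ℝ ∞ φ (f t)) (hG : DifferentiableAt ℝ G (φ (f t)))
    (hiso : ∀ᶠ z in 𝓝 (f t), ∀ u v, G (φ z) (fderiv ℝ φ z u) (fderiv ℝ φ z v) = G z u v)
    (hbij : Function.Bijective (fderiv ℝ φ (f t))) :
    HasMeanCurvatureVector (fun z u v => G z u v) (fun s => φ (f s)) t (fderiv ℝ φ (f t) η) := by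
  have h0 : fderiv ℝ (fun r => φ (f r)) t = (fderiv ℝ φ (f t)).comp (fderiv ℝ f t) :=
    fderiv_comp t (hφ.differentiableAt (by simp)) (h.smooth.differentiableAt (by simp))
  have hi := hiso.self_of_nhds
  refine ⟨hφ.comp t h.smooth, ?_, ?_, ?_⟩
  · rw [h0]
    exact hbij.1.comp h.immersion
  · intro u
    rw [h0, ContinuousLinearMap.comp_apply, hi]
    exact h.normal u
  · obtain ⟨e, he, htr⟩ := h.trace
    refine ⟨e, fun i j => ?_, fun ν hν => ?_⟩
    · rw [h0, ContinuousLinearMap.comp_apply, ContinuousLinearMap.comp_apply, hi]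
      exact he i j
    -- By surjectivity of the differential, every normal vector of `φ ∘ f` comes from one of `f`.
    · obtain ⟨ν, rfl⟩ := hbij.2 ν
      rw [hi, htr ν]
      · exact Finset.sum_congr rfl fun i _ =>
          (secondFundamentalForm_isometry_comp hsymm hφ h.smooth hG hiso ν _ _).symm
      · intro u
        have := hν u
        rwa [h0, ContinuousLinearMap.comp_apply, hi] at this

/-- Only the germ of `f` at `t` matters. This is needed because the orbit map factors as `g` after
the chart at `o` only where the denominators of the action are nonzero. -/
theorem HasMeanCurvatureVector.congr_of_eventuallyEq {g : E → E → E → ℝ} {k : ℕ}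
    {f f' : (Fin k → ℝ) → E} {t : Fin k → ℝ} {η : E} (h : HasMeanCurvatureVector g f t η)
    (hff' : f' =ᶠ[𝓝 t] f) : HasMeanCurvatureVector g f' t η := by
  have h0 : f' t = f t := hff'.self_of_nhds
  have h1 : fderiv ℝ f' t = fderiv ℝ f t := hff'.fderiv_eq
  have h2 : fderiv ℝ (fun s => fderiv ℝ f' s) t = fderiv ℝ (fun s => fderiv ℝ f s) t :=
    hff'.fderiv.fderiv_eq
  refine ⟨h.smooth.congr_of_eventuallyEq hff', ?_, ?_, ?_⟩
  · rw [h1]; exact h.immersion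
  · rw [h0, h1]; exact h.normal
  · unfold secondFundamentalForm
    rw [h0, h1, h2]
    exact h.trace

end Naturality

/-! ### The form of signature `(1, n)` and the metric in homogeneous coordinates. -/

section HermitianForm

variable {n : ℕ}

/-- The Hermitian form of signature `(1, n)`. -/
def herm (x y : Fin (n + 1) → ℂ) : ℂ := star x ⬝ᵥ (form n *ᵥ y)

theorem herm_add_left (x x' y : Fin (n + 1) → ℂ) : herm (x + x') y = herm x y + herm x' y := by
  simp [herm, add_dotProduct]

theorem herm_add_right (x y y' : Fin (n + 1) → ℂ) : herm x (y + y') = herm x y + herm x y' := by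
  simp [herm, Matrix.mulVec_add, dotProduct_add]

theorem herm_smul_left (c : ℂ) (x y : Fin (n + 1) → ℂ) :
    herm (c • x) y = (starRingEnd ℂ) c * herm x y := by
  simp [herm]

theorem herm_smul_right (c : ℂ) (x y : Fin (n + 1) → ℂ) : herm x (c • y) = c * herm x y := by
  simp [herm, Matrix.mulVec_smul]

theorem herm_cons (c d : ℂ) (u v : EuclideanSpace ℂ (Fin n)) :
    herm (Fin.cons c u.ofLp) (Fin.cons d v.ofLp) = -((starRingEnd ℂ) c * d) + inner ℂ u v := by
  simp [herm, form, dotProduct, Matrix.mulVec_diagonal, Fin.sum_univ_succ, PiLp.inner_apply,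
    mul_comm]

theorem herm_mulVec (g : SU n) (x y : Fin (n + 1) → ℂ) :
    herm (g.1.1 *ᵥ x) (g.1.1 *ᵥ y) = herm x y := by
  have hg : g.1.1ᴴ * form n * g.1.1 = form n := g.2
  unfold herm
  rw [Matrix.star_mulVec, ← Matrix.dotProduct_mulVec, Matrix.mulVec_mulVec, Matrix.mulVec_mulVec,
    hg]

/-- The expression of the metric of `ℂHⁿ` in homogeneous coordinates. -/
def homogeneousMetric (ζ x y : Fin (n + 1) → ℂ) : ℂ :=
  (herm x ζ * herm ζ y - herm x y * herm ζ ζ) / herm ζ ζ ^ 2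

/-- With `homogeneousMetric_smul`, this says that the expression descends to projective space:
neither the representative of a point nor the lift of a tangent vector matters. -/
theorem homogeneousMetric_add_smul (ζ x y : Fin (n + 1) → ℂ) (c d : ℂ) :
    homogeneousMetric ζ (x + c • ζ) (y + d • ζ) = homogeneousMetric ζ x y := by
  unfold homogeneousMetric
  simp only [herm_add_left, herm_add_right, herm_smul_left, herm_smul_right]
  congr 1
  ring

theorem homogeneousMetric_smul (ζ x y : Fin (n + 1) → ℂ) {c : ℂ} (hc : c ≠ 0) :
    homogeneousMetric (c • ζ) (c • x) (c • y) = homogeneousMetric ζ x y := by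
  have hc' : (starRingEnd ℂ) c ≠ 0 := by simpa using hc
  unfold homogeneousMetric
  simp only [herm_smul_left, herm_smul_right]
  by_cases h : herm ζ ζ = 0
  · simp [h]
  · field_simp

theorem homogeneousMetric_mulVec (g : SU n) (ζ x y : Fin (n + 1) → ℂ) :
    homogeneousMetric (g.1.1 *ᵥ ζ) (g.1.1 *ᵥ x) (g.1.1 *ᵥ y) = homogeneousMetric ζ x y := by
  simp only [homogeneousMetric, herm_mulVec]

theorem herm_cons_one_self (z : EuclideanSpace ℂ (Fin n)) :
    herm (Fin.cons 1 z.ofLp) (Fin.cons 1 z.ofLp) = ((‖z‖ ^ 2 - 1 : ℝ) : ℂ) := by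
  rw [herm_cons, inner_self_eq_norm_sq_to_K]
  simp
  ring

theorem metric_eq_homogeneousMetric {z : EuclideanSpace ℂ (Fin n)} (hz : ‖z‖ < 1)
    (u v : EuclideanSpace ℂ (Fin n)) :
    metric z u v =
      4 * (homogeneousMetric (Fin.cons 1 z.ofLp) (Fin.cons 0 u.ofLp) (Fin.cons 0 v.ofLp)).re := by
  have h1 : (‖z‖ : ℂ) ^ 2 - 1 ≠ 0 := by
    have : ‖z‖ ^ 2 - 1 ≠ 0 := by nlinarith [norm_nonneg z]
    exact_mod_cast this
  have h2 : 1 - (‖z‖ : ℂ) ^ 2 ≠ 0 := by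
    rw [← neg_sub]; exact neg_ne_zero.2 h1
  unfold metric homogeneousMetric
  rw [herm_cons_one_self]
  simp only [herm_cons]
  congr 2
  push_cast
  simp only [map_zero, mul_zero, neg_zero, zero_add, map_one, mul_one]
  rw [div_add_div _ _ h2 (pow_ne_zero 2 h2), div_eq_div_iff (by positivity) (by positivity)]
  ring

end HermitianForm

/-! ### Bilinearity, smoothness and symmetry of the ball metric. -/

section Metric

variable {n : ℕ}

theorem metric_add_left (z u u' v : EuclideanSpace ℂ (Fin n)) :
    metric z (u + u') v = metric z u v + metric z u' v := by
  simp only [metric, inner_add_left, ← mul_add, ← Complex.add_re]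
  congr 2
  ring

theorem metric_smul_left (z u v : EuclideanSpace ℂ (Fin n)) (c : ℝ) :
    metric z (c • u) v = c * metric z u v := by
  have h : ∀ x : EuclideanSpace ℂ (Fin n), inner ℂ (c • u) x = (c : ℂ) * inner ℂ u x := fun x => by
    rw [inner_smul_left_eq_smul]; simp
  simp only [metric, h]
  rw [mul_left_comm c 4, ← Complex.re_ofReal_mul c]
  congr 2
  ring

theorem metric_comm (z u v : EuclideanSpace ℂ (Fin n)) : metric z u v = metric z v u := by
  unfold metric
  congr 1
  rw [← Complex.conj_re]
  congr 1
  simp [mul_comm]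

theorem metric_neg_base (z u v : EuclideanSpace ℂ (Fin n)) : metric (-z) u v = metric z u v := by
  simp [metric]

theorem metric_zero_base (u v : EuclideanSpace ℂ (Fin n)) :
    metric 0 u v = 4 * (inner ℂ u v).re := by
  simp [metric]

/-- The metric of `ℂHⁿ` as a family of continuous bilinear forms. -/
def metricForm (z : EuclideanSpace ℂ (Fin n)) :
    EuclideanSpace ℂ (Fin n) →L[ℝ] EuclideanSpace ℂ (Fin n) →L[ℝ] ℝ :=
  LinearMap.toContinuousBilinearMap
    (LinearMap.mk₂ ℝ (metric z) (metric_add_left z)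
      (fun c u v => metric_smul_left z u v c)
      (fun u v v' => by simp only [metric_comm z u, metric_add_left])
      (fun c u v => by simp only [metric_comm z u, metric_smul_left, smul_eq_mul]))

theorem metricForm_apply (z u v : EuclideanSpace ℂ (Fin n)) : metricForm z u v = metric z u v :=
  rfl

theorem metric_eq_metricForm :
    (metric : EuclideanSpace ℂ (Fin n) → _ → _ → ℝ) = fun z u v => metricForm z u v := rfl

theorem contDiffOn_metric (u v : EuclideanSpace ℂ (Fin n)) :
    ContDiffOn ℝ ∞ (fun z => metric z u v) (Metric.ball 0 1) := by
  have h1 : ContDiff ℝ ∞ fun z : EuclideanSpace ℂ (Fin n) => 1 - (‖z‖ : ℂ) ^ 2 := by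
    have : ContDiff ℝ ∞ fun z : EuclideanSpace ℂ (Fin n) => ((‖z‖ ^ 2 : ℝ) : ℂ) :=
      Complex.ofRealCLM.contDiff.comp (contDiff_norm_sq ℂ)
    simp only [Complex.ofReal_pow] at this
    exact contDiff_const.sub this
  have h0 : ∀ z ∈ Metric.ball (0 : EuclideanSpace ℂ (Fin n)) 1, 1 - (‖z‖ : ℂ) ^ 2 ≠ 0 := by
    intro z hz
    have hz : ‖z‖ < 1 := by simpa using hz
    have : 1 - ‖z‖ ^ 2 ≠ 0 := by nlinarith [norm_nonneg z]
    exact_mod_cast this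
  have h2 : ContDiff ℝ ∞ fun z : EuclideanSpace ℂ (Fin n) => inner ℂ u z :=
    contDiff_const.inner ℂ contDiff_id
  have h3 : ContDiff ℝ ∞ fun z : EuclideanSpace ℂ (Fin n) => inner ℂ z v :=
    contDiff_id.inner ℂ contDiff_const
  unfold metric
  refine contDiffOn_const.mul
    (Complex.reCLM.contDiff.comp_contDiffOn (f := fun z => inner ℂ u v / (1 - (‖z‖ : ℂ) ^ 2)
      + inner ℂ u z * inner ℂ z v / (1 - (‖z‖ : ℂ) ^ 2) ^ 2) (ContDiffOn.add ?_ ?_))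
  · simp only [div_eq_mul_inv]
    exact contDiffOn_const.mul (h1.contDiffOn.inv h0)
  · simp only [div_eq_mul_inv]
    exact (h2.mul h3).contDiffOn.mul
      ((h1.pow 2).contDiffOn.inv fun z hz => pow_ne_zero 2 (h0 z hz))

theorem differentiableAt_metricForm {z : EuclideanSpace ℂ (Fin n)} (hz : ‖z‖ < 1) :
    DifferentiableAt ℝ (metricForm (n := n)) z := by
  have : ContDiffOn ℝ ∞ (metricForm (n := n)) (Metric.ball 0 1) := by
    refine contDiffOn_clm_apply.2 fun u => contDiffOn_clm_apply.2 fun v => ?_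
    exact contDiffOn_metric u v
  exact (this.contDiffAt (Metric.isOpen_ball.mem_nhds (by simpa using hz))).differentiableAt
    (by simp)

/-- The coefficients are even functions of `z`, so their first derivatives vanish at the origin. -/
theorem christoffel_metric_zero (u v w : EuclideanSpace ℂ (Fin n)) :
    christoffel metric 0 u v w = 0 := by
  have h : ∀ u v : EuclideanSpace ℂ (Fin n), fderiv ℝ (fun z => metric z u v) 0 = 0 := by
    intro u v
    have hd : HasFDerivAt (fun z => metric z u v) (fderiv ℝ (fun z => metric z u v) 0) 0 :=
      (((contDiffOn_metric u v).contDiffAt (Metric.isOpen_ball.mem_nhds (by simp))).differentiableAt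
        (by simp)).hasFDerivAt
    have hd' : HasFDerivAt (fun z => metric (-z) u v) _ (0 : EuclideanSpace ℂ (Fin n)) :=
      HasFDerivAt.comp (f := fun z => -z) (g := fun z => metric z u v) (0 : EuclideanSpace ℂ (Fin n))
        (by simpa using hd) (hasFDerivAt_id (𝕜 := ℝ) _).neg
    simp only [metric_neg_base] at hd'
    have := hd.unique hd'
    ext x
    have := congrArg (fun L => L x) this
    simp at this
    simp
    linarith
  simp [christoffel, h]

end Metric

/-! ### The isometric action of `SU(1,n)` on the ball. -/

section Action

variable {n : ℕ}

/-- The linear part of the homogeneous coordinates of `act A z`. -/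
def rowMap (A : Matrix (Fin (n + 1)) (Fin (n + 1)) ℂ) (i : Fin (n + 1)) :
    EuclideanSpace ℂ (Fin n) →L[ℝ] ℂ :=
  LinearMap.toContinuousLinearMap
    { toFun := fun u => (A *ᵥ Fin.cons 0 u.ofLp) i
      map_add' := fun u v => by
        simp [Matrix.mulVec, dotProduct, Fin.sum_univ_succ, mul_add, Finset.sum_add_distrib]
      map_smul' := fun c u => by
        simp [Matrix.mulVec, dotProduct, Fin.sum_univ_succ, Finset.mul_sum, mul_left_comm] }

theorem rowMap_apply (A : Matrix (Fin (n + 1)) (Fin (n + 1)) ℂ) (i : Fin (n + 1))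
    (u : EuclideanSpace ℂ (Fin n)) : rowMap A i u = (A *ᵥ Fin.cons 0 u.ofLp) i := rfl

theorem mulVec_cons_one (A : Matrix (Fin (n + 1)) (Fin (n + 1)) ℂ) (i : Fin (n + 1))
    (z : EuclideanSpace ℂ (Fin n)) :
    (A *ᵥ Fin.cons 1 z.ofLp) i = A i 0 + rowMap A i z := by
  simp [rowMap_apply, Matrix.mulVec, dotProduct, Fin.sum_univ_succ]

theorem act_apply (A : Matrix (Fin (n + 1)) (Fin (n + 1)) ℂ) (z : EuclideanSpace ℂ (Fin n))
    (i : Fin n) : act A z i = (A i.succ 0 + rowMap A i.succ z) / (A 0 0 + rowMap A 0 z) := by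
  rw [← mulVec_cons_one, ← mulVec_cons_one]
  rfl

theorem contDiffAt_act {A : Matrix (Fin (n + 1)) (Fin (n + 1)) ℂ} {z : EuclideanSpace ℂ (Fin n)}
    (h : A 0 0 + rowMap A 0 z ≠ 0) : ContDiffAt ℝ ∞ (act A) z := by
  refine (contDiffAt_piLp 2).2 fun i => ?_
  simp only [act_apply, div_eq_mul_inv]
  exact (contDiffAt_const.add (rowMap A i.succ).contDiff.contDiffAt).mul
    ((contDiffAt_const.add (rowMap A 0).contDiff.contDiffAt).inv h)

theorem fderiv_act_apply {A : Matrix (Fin (n + 1)) (Fin (n + 1)) ℂ}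
    {z : EuclideanSpace ℂ (Fin n)} (h : A 0 0 + rowMap A 0 z ≠ 0) (u : EuclideanSpace ℂ (Fin n))
    (i : Fin n) :
    fderiv ℝ (act A) z u i =
      (rowMap A i.succ u * (A 0 0 + rowMap A 0 z) - (A i.succ 0 + rowMap A i.succ z) * rowMap A 0 u)
        / (A 0 0 + rowMap A 0 z) ^ 2 := by
  have h1 := ((contDiffAt_act h).differentiableAt (by simp)).hasFDerivAt
  have h2 : HasFDerivAt (fun y => act A y i) _ z :=
    (PiLp.hasFDerivAt_apply (𝕜 := ℝ) 2 (act A z) i).comp z h1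
  have hN : HasFDerivAt (fun z => A i.succ 0 + rowMap A i.succ z) (rowMap A i.succ) z :=
    (rowMap A i.succ).hasFDerivAt.const_add _
  have hD : HasFDerivAt (fun z => A 0 0 + rowMap A 0 z) (rowMap A 0) z :=
    (rowMap A 0).hasFDerivAt.const_add _
  -- The quotient is differentiated implicitly, through (value) · (denominator) = numerator.
  have h3 : (fun y => act A y i * (A 0 0 + rowMap A 0 y)) =ᶠ[𝓝 z]
      fun y => A i.succ 0 + rowMap A i.succ y := by
    filter_upwards [hD.continuousAt.eventually_ne h] with y hy
    rw [act_apply, div_mul_cancel₀ _ hy]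
  have h4 := (h2.mul hD).unique (hN.congr_of_eventuallyEq h3)
  have h5 := congrArg (fun L => L u) h4
  simp only [add_apply, smul_apply, smul_eq_mul, ContinuousLinearMap.comp_apply, PiLp.proj_apply,
    act_apply] at h5
  rw [← h5]
  field_simp
  ring

theorem cons_one_act {A : Matrix (Fin (n + 1)) (Fin (n + 1)) ℂ} {z : EuclideanSpace ℂ (Fin n)}
    (h : (A *ᵥ Fin.cons 1 z.ofLp) 0 ≠ 0) :
    (Fin.cons 1 (act A z).ofLp : Fin (n + 1) → ℂ) =
      ((A *ᵥ Fin.cons 1 z.ofLp) 0)⁻¹ • (A *ᵥ Fin.cons 1 z.ofLp) := by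
  ext i
  refine Fin.cases ?_ (fun i => ?_) i
  · simp [h]
  · simp [act, div_eq_inv_mul]

/-- The lift of the differential is the linear image of `(0, u)` up to a multiple of the image of
the point and the scalar that normalizes that image. These are the two ambiguities that
`homogeneousMetric` ignores. -/
theorem cons_zero_fderiv_act {A : Matrix (Fin (n + 1)) (Fin (n + 1)) ℂ}
    {z : EuclideanSpace ℂ (Fin n)} (h : (A *ᵥ Fin.cons 1 z.ofLp) 0 ≠ 0)
    (u : EuclideanSpace ℂ (Fin n)) :
    (Fin.cons 0 (fderiv ℝ (act A) z u).ofLp : Fin (n + 1) → ℂ) =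
      ((A *ᵥ Fin.cons 1 z.ofLp) 0)⁻¹ • (A *ᵥ Fin.cons 0 u.ofLp
        + (-((A *ᵥ Fin.cons 0 u.ofLp) 0 / (A *ᵥ Fin.cons 1 z.ofLp) 0))
          • (A *ᵥ Fin.cons 1 z.ofLp)) := by
  ext i
  refine Fin.cases ?_ (fun i => ?_) i
  · simp [h]
  · have h' := h
    rw [mulVec_cons_one] at h'
    simp only [Fin.cons_succ, fderiv_act_apply h', Pi.smul_apply, Pi.add_apply, smul_eq_mul,
      ← rowMap_apply, mulVec_cons_one]
    field_simp
    ring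

/-- The form is negative on `(1, z)`, hence on its image under `g`, but nonnegative on vectors whose
zeroth coordinate vanishes. -/
theorem mulVec_cons_one_ne_zero (g : SU n) {z : EuclideanSpace ℂ (Fin n)} (hz : ‖z‖ < 1) :
    (g.1.1 *ᵥ Fin.cons 1 z.ofLp) 0 ≠ 0 := by
  intro h0
  set Z := g.1.1 *ᵥ Fin.cons 1 z.ofLp with hZ
  have h1 : herm Z Z = ((‖z‖ ^ 2 - 1 : ℝ) : ℂ) := by
    rw [hZ, herm_mulVec, herm_cons_one_self]
  have h2 : Z = Fin.cons 0 (WithLp.toLp 2 (Fin.tail Z)).ofLp := by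
    rw [← h0]; exact (Fin.cons_self_tail Z).symm
  rw [h2, herm_cons, inner_self_eq_norm_sq_to_K] at h1
  simp only [mul_zero, neg_zero, zero_add] at h1
  have h3 : ‖WithLp.toLp 2 (Fin.tail Z)‖ ^ 2 = ‖z‖ ^ 2 - 1 := 
    Complex.ofReal_injective (by simpa using h1)
  nlinarith [norm_nonneg z, sq_nonneg ‖WithLp.toLp 2 (Fin.tail Z)‖]

/-- Membership in the ball means that the form is negative on `(1, z)`; `g` preserves the form, and
normalization multiplies it by a positive number. -/
theorem norm_act_lt_one (g : SU n) {z : EuclideanSpace ℂ (Fin n)} (hz : ‖z‖ < 1) :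
    ‖act g.1.1 z‖ < 1 := by
  have h0 := mulVec_cons_one_ne_zero g hz
  have h1 := herm_cons_one_self (act g.1.1 z)
  rw [cons_one_act h0, herm_smul_left, herm_smul_right, herm_mulVec, herm_cons_one_self,
    ← mul_assoc, mul_comm ((starRingEnd ℂ) _), Complex.mul_conj] at h1
  have h2 : Complex.normSq ((g.1.1 *ᵥ Fin.cons 1 z.ofLp) 0)⁻¹ * (‖z‖ ^ 2 - 1) =
      ‖act g.1.1 z‖ ^ 2 - 1 := by exact_mod_cast h1
  have h3 : 0 < Complex.normSq ((g.1.1 *ᵥ Fin.cons 1 z.ofLp) 0)⁻¹ :=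
    Complex.normSq_pos.2 (inv_ne_zero h0)
  have h4 : ‖z‖ ^ 2 - 1 < 0 := by nlinarith [norm_nonneg z]
  nlinarith [mul_neg_of_pos_of_neg h3 h4, norm_nonneg (act g.1.1 z)]

/-- `SU(1,n)` acts on the ball by isometries. -/
theorem metric_act (g : SU n) {z : EuclideanSpace ℂ (Fin n)} (hz : ‖z‖ < 1)
    (u v : EuclideanSpace ℂ (Fin n)) :
    metric (act g.1.1 z) (fderiv ℝ (act g.1.1) z u) (fderiv ℝ (act g.1.1) z v) = metric z u v := by
  have h0 := mulVec_cons_one_ne_zero g hz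
  rw [metric_eq_homogeneousMetric (norm_act_lt_one g hz), metric_eq_homogeneousMetric hz,
    cons_one_act h0, cons_zero_fderiv_act h0, cons_zero_fderiv_act h0,
    homogeneousMetric_smul _ _ _ (inv_ne_zero h0), homogeneousMetric_add_smul,
    homogeneousMetric_mulVec]

theorem act_mul {A C : Matrix (Fin (n + 1)) (Fin (n + 1)) ℂ} {z : EuclideanSpace ℂ (Fin n)}
    (h : (C *ᵥ Fin.cons 1 z.ofLp) 0 ≠ 0) : act (A * C) z = act A (act C z) := by
  have h1 := cons_one_act h
  ext i
  simp only [act, ← Matrix.mulVec_mulVec] at h1 ⊢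
  rw [h1, Matrix.mulVec_smul]
  simp only [Pi.smul_apply, smul_eq_mul]
  rw [mul_div_mul_left _ _ (inv_ne_zero h)]

/-- The differential preserves a positive definite form, so it is injective, and the dimension is
finite. -/
theorem bijective_fderiv_act (g : SU n) :
    Function.Bijective (fderiv ℝ (act g.1.1) (0 : EuclideanSpace ℂ (Fin n))) := by
  have hinj : Function.Injective (fderiv ℝ (act g.1.1) (0 : EuclideanSpace ℂ (Fin n))) := by
    refine (injective_iff_map_eq_zero _).2 fun u hu => ?_
    have h := metric_act g (z := 0) (by simp) u u
    rw [hu, metric_zero_base, inner_self_eq_norm_sq_to_K] at h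
    have h0 : metric (act g.1.1 0) 0 (0 : EuclideanSpace ℂ (Fin n)) = 0 := by simp [metric]
    rw [h0] at h
    have : ‖u‖ ^ 2 = 0 := by
      have h' : (0 : ℝ) = 4 * ‖u‖ ^ 2 := by
        rw [h]; norm_cast
      linarith
    simpa using this
  exact ⟨hinj, LinearMap.injective_iff_surjective.1 hinj⟩

/-- Mean curvature vectors at the base point are transported by `SU(1,n)`. -/
theorem HasMeanCurvatureVector.act_comp (g : SU n) {k : ℕ}
    {f : (Fin k → ℝ) → EuclideanSpace ℂ (Fin n)} {t : Fin k → ℝ} {η : EuclideanSpace ℂ (Fin n)}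
    (hft : f t = 0) (h : HasMeanCurvatureVector metric f t η) :
    HasMeanCurvatureVector metric (fun s => act g.1.1 (f s)) t (fderiv ℝ (act g.1.1) 0 η) := by
  rw [metric_eq_metricForm] at h ⊢
  have h0 : ‖(0 : EuclideanSpace ℂ (Fin n))‖ < 1 := by simp
  have := h.isometry_comp (φ := act g.1.1) (fun z u v => metric_comm z u v)
    (by
      rw [hft]
      refine contDiffAt_act ?_
      rw [← mulVec_cons_one]
      exact mulVec_cons_one_ne_zero g h0)
    (by rw [hft]; exact differentiableAt_metricForm (norm_act_lt_one g h0))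
    (by
      rw [hft]
      filter_upwards [Metric.isOpen_ball.mem_nhds (Metric.mem_ball_self zero_lt_one)] with z hz
      exact metric_act g (by simpa using hz))
    (by rw [hft]; exact bijective_fderiv_act g)
  rwa [hft] at this

end Action

/-! ### Velocity and acceleration of the curves `s ↦ exp(sA) · o`. -/

section Exponential

variable {n : ℕ}

theorem hasDerivAt_exp_smul_apply (A : Matrix (Fin (n + 1)) (Fin (n + 1)) ℂ) (i j : Fin (n + 1))
    (s : ℝ) : HasDerivAt (fun s : ℝ => NormedSpace.exp (s • A) i j)
      ((A * NormedSpace.exp (s • A)) i j) s := by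
  -- A submultiplicative norm is chosen only to differentiate the exponential; the entrywise
  -- statement does not involve it.
  let _ : NormedRing (Matrix (Fin (n + 1)) (Fin (n + 1)) ℂ) := Matrix.linftyOpNormedRing
  let _ : NormedAlgebra ℝ (Matrix (Fin (n + 1)) (Fin (n + 1)) ℂ) := Matrix.linftyOpNormedAlgebra
  have h := hasDerivAt_exp_smul_const' (𝕂 := ℝ) A s
  exact (LinearMap.toContinuousLinearMap (Matrix.entryLinearMap ℝ ℂ i j)).hasFDerivAt.comp_hasDerivAt
    s h

theorem contDiff_exp_sum_smul_apply {k : ℕ} (M : Fin k → Matrix (Fin (n + 1)) (Fin (n + 1)) ℂ)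
    (i j : Fin (n + 1)) :
    ContDiff ℝ ∞ fun t : Fin k → ℝ => NormedSpace.exp (∑ l, t l • M l) i j := by
  let _ : NormedRing (Matrix (Fin (n + 1)) (Fin (n + 1)) ℂ) := Matrix.linftyOpNormedRing
  let _ : NormedAlgebra ℝ (Matrix (Fin (n + 1)) (Fin (n + 1)) ℂ) := Matrix.linftyOpNormedAlgebra
  have h1 : ContDiff ℝ ∞ fun t : Fin k → ℝ => ∑ l, t l • M l :=
    ContDiff.sum fun l _ => (contDiff_apply ℝ ℝ l).smul contDiff_const
  have h2 : ContDiff ℝ ∞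
      (NormedSpace.exp : Matrix (Fin (n + 1)) (Fin (n + 1)) ℂ → _) :=
    contDiff_iff_contDiffAt.2 fun A => (NormedSpace.exp_analytic (𝕂 := ℝ) A).contDiffAt
  exact (LinearMap.toContinuousLinearMap (Matrix.entryLinearMap ℝ ℂ i j)).contDiff.comp
    (h2.comp h1)

theorem hasDerivAt_toLp {F : ℝ → Fin n → ℂ} {F' : Fin n → ℂ} {s : ℝ}
    (h : ∀ i, HasDerivAt (fun s => F s i) (F' i) s) :
    HasDerivAt (fun s => (WithLp.toLp 2 (F s) : EuclideanSpace ℂ (Fin n))) (WithLp.toLp 2 F') s :=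
  (PiLp.continuousLinearEquiv 2 ℝ fun _ : Fin n => ℂ).symm.hasFDerivAt.comp_hasDerivAt s
    (hasDerivAt_pi.2 h)

theorem act_zero (C : Matrix (Fin (n + 1)) (Fin (n + 1)) ℂ) :
    act C 0 = WithLp.toLp 2 fun i => C i.succ 0 / C 0 0 := by
  ext i
  rw [act_apply, map_zero, map_zero, add_zero, add_zero]

/-- The tangent vector at `o` of `s ↦ exp(sA) · o`. -/
def tangent : Matrix (Fin (n + 1)) (Fin (n + 1)) ℂ →ₗ[ℝ] EuclideanSpace ℂ (Fin n) where
  toFun A := WithLp.toLp 2 fun i => A i.succ 0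
  map_add' _ _ := rfl
  map_smul' _ _ := rfl

theorem tangent_apply (A : Matrix (Fin (n + 1)) (Fin (n + 1)) ℂ) (i : Fin n) :
    tangent A i = A i.succ 0 := rfl

/-- The second derivative at `s = 0` of `s ↦ exp(sA) · o`. -/
def acceleration (A : Matrix (Fin (n + 1)) (Fin (n + 1)) ℂ) : EuclideanSpace ℂ (Fin n) :=
  WithLp.toLp 2 fun i => (A * A) i.succ 0 - 2 * (A i.succ 0 * A 0 0)

/-- The velocity of the curve `s ↦ exp(sA) · o`. -/
def velocity (A : Matrix (Fin (n + 1)) (Fin (n + 1)) ℂ) (s : ℝ) : EuclideanSpace ℂ (Fin n) :=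
  WithLp.toLp 2 fun i =>
    ((A * NormedSpace.exp (s • A)) i.succ 0 * NormedSpace.exp (s • A) 0 0
      - NormedSpace.exp (s • A) i.succ 0 * (A * NormedSpace.exp (s • A)) 0 0)
      / NormedSpace.exp (s • A) 0 0 ^ 2

theorem hasDerivAt_act_exp {A : Matrix (Fin (n + 1)) (Fin (n + 1)) ℂ} {s : ℝ}
    (h : NormedSpace.exp (s • A) 0 0 ≠ 0) :
    HasDerivAt (fun s : ℝ => act (NormedSpace.exp (s • A)) 0) (velocity A s) s := by
  simp only [act_zero]
  exact hasDerivAt_toLp fun i =>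
    (hasDerivAt_exp_smul_apply A i.succ 0 s).div (hasDerivAt_exp_smul_apply A 0 0 s) h

theorem velocity_zero (A : Matrix (Fin (n + 1)) (Fin (n + 1)) ℂ) : velocity A 0 = tangent A := by
  ext i
  simp [velocity, tangent_apply, NormedSpace.exp_zero]

/-- Each coordinate of the curve is `N/D` with `N = 0` and `D = 1` at `s = 0`, so its second
derivative there is `N'' - 2N'D'`. -/
theorem hasDerivAt_velocity (A : Matrix (Fin (n + 1)) (Fin (n + 1)) ℂ) :
    HasDerivAt (velocity A) (acceleration A) 0 := by
  refine hasDerivAt_toLp fun i => ?_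
  have h1 : ∀ i, HasDerivAt (fun s : ℝ => (A * NormedSpace.exp (s • A)) i 0) ((A * A) i 0) 0 := by
    intro i
    simp only [Matrix.mul_apply]
    refine HasDerivAt.fun_sum fun j _ => ?_
    have := (hasDerivAt_exp_smul_apply A j 0 0).const_mul (A i j)
    simpa [NormedSpace.exp_zero] using this
  have hN := hasDerivAt_exp_smul_apply A i.succ 0 0
  have hD := hasDerivAt_exp_smul_apply A 0 0 0
  have h := (((h1 i.succ).mul hD).sub (hN.mul (h1 0))).div (hD.pow 2)
    (by simp [NormedSpace.exp_zero])
  refine h.congr_deriv ?_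
  simp [NormedSpace.exp_zero]
  ring

theorem eventually_exp_apply_ne_zero (A : Matrix (Fin (n + 1)) (Fin (n + 1)) ℂ) :
    ∀ᶠ s : ℝ in 𝓝 0, NormedSpace.exp (s • A) 0 0 ≠ 0 :=
  (hasDerivAt_exp_smul_apply A 0 0 0).continuousAt.eventually_ne (by simp [NormedSpace.exp_zero])

/-- The second derivative of a map along a line. -/
theorem fderiv_fderiv_apply_self {E F : Type*} [NormedAddCommGroup E] [NormedSpace ℝ E]
    [NormedAddCommGroup F] [NormedSpace ℝ F] {f : E → F} (hf : ContDiffAt ℝ ∞ f 0) {u : E}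
    {d : ℝ → F} {q : F} (hd : ∀ᶠ s : ℝ in 𝓝 0, HasDerivAt (fun s : ℝ => f (s • u)) (d s) s)
    (hq : HasDerivAt d q 0) : fderiv ℝ (fun z => fderiv ℝ f z) 0 u u = q := by
  have hf2 : HasFDerivAt (fun z => fderiv ℝ f z) (fderiv ℝ (fun z => fderiv ℝ f z) 0) 0 :=
    ((hf.fderiv_right (m := 1) (by norm_cast)).differentiableAt (by simp)).hasFDerivAt
  have hl : ∀ s : ℝ, HasDerivAt (fun s : ℝ => s • u) u s := fun s => by
    simpa using (hasDerivAt_id s).smul_const u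
  have hc : Tendsto (fun s : ℝ => s • u) (𝓝 0) (𝓝 0) := by
    simpa using (hl 0).continuousAt.tendsto
  -- By uniqueness of derivatives `d` is the directional derivative along the line, so
  -- differentiating it once more gives the Hessian on `(u, u)`.
  have hev : d =ᶠ[𝓝 0] fun s : ℝ => fderiv ℝ f (s • u) u := by
    have h2 := (hf.of_le (m := 1) (by norm_cast)).eventually (by simp)
    filter_upwards [hd, hc.eventually h2] with s hs hs2
    exact hs.unique ((hs2.differentiableAt (by simp)).hasFDerivAt.comp_hasDerivAt s (hl s))
  have h3 : HasDerivAt (fun s : ℝ => fderiv ℝ f (s • u)) (fderiv ℝ (fun z => fderiv ℝ f z) 0 u) 0 :=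
    HasFDerivAt.comp_hasDerivAt (l := fun z => fderiv ℝ f z) (f := fun s : ℝ => s • u) (0 : ℝ)
      (by simpa using hf2) (hl 0)
  have h4 := h3.clm_apply (hasDerivAt_const (0 : ℝ) u)
  have h5 := (hq.congr_of_eventuallyEq hev.symm).unique h4
  simpa using h5.symm

theorem leftInvariantVector_eq (g : SU n) (Y : su n) :
    leftInvariantVector g Y = fderiv ℝ (act g.1.1) 0 (tangent Y.1) := by
  have h0 : ‖(0 : EuclideanSpace ℂ (Fin n))‖ < 1 := by simp
  have h1 : (fun s : ℝ => act (g.1.1 * NormedSpace.exp (s • Y.1)) (basePoint n)) =ᶠ[𝓝 0]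
      fun s : ℝ => act g.1.1 (act (NormedSpace.exp (s • Y.1)) 0) := by
    filter_upwards [eventually_exp_apply_ne_zero Y.1] with s hs
    refine act_mul ?_
    rw [basePoint, mulVec_cons_one, map_zero, add_zero]
    exact hs
  have h2 : HasDerivAt (fun s : ℝ => act (NormedSpace.exp (s • Y.1)) 0) (tangent Y.1) 0 := by
    rw [← velocity_zero]
    exact hasDerivAt_act_exp (by simp [NormedSpace.exp_zero])
  have h3 : DifferentiableAt ℝ (act g.1.1) (0 : EuclideanSpace ℂ (Fin n)) := by
    refine (contDiffAt_act ?_).differentiableAt (by simp)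
    rw [← mulVec_cons_one]
    exact mulVec_cons_one_ne_zero g h0
  have h4 : act (NormedSpace.exp ((0 : ℝ) • Y.1)) 0 = 0 := by
    ext i
    simp [act_zero, NormedSpace.exp_zero]
  have h5 := HasFDerivAt.comp_hasDerivAt (l := act g.1.1) (0 : ℝ) (by rw [h4]; exact h3.hasFDerivAt)
    h2
  exact (h5.congr_of_eventuallyEq h1).deriv

theorem leftInvariantVector_one (Y : su n) : leftInvariantVector 1 Y = tangent Y.1 := by
  have h2 : HasDerivAt (fun s : ℝ => act (NormedSpace.exp (s • Y.1)) 0) (tangent Y.1) 0 := by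
    rw [← velocity_zero]
    exact hasDerivAt_act_exp (by simp [NormedSpace.exp_zero])
  simpa [leftInvariantVector, basePoint] using h2.deriv

theorem innerAN_eq (Y Y' : su n) : innerAN Y Y' = 4 * (inner ℂ (tangent Y.1) (tangent Y'.1)).re := by
  rw [innerAN, leftInvariantVector_one, leftInvariantVector_one, basePoint, metric_zero_base]

end Exponential

/-! ### Reduction of the mean curvature of an orbit to accelerations at `o`. -/

section Orbit

variable {n : ℕ}

/-- The chart of the orbit at the base point. -/
def expChart {k : ℕ} (M : Fin k → Matrix (Fin (n + 1)) (Fin (n + 1)) ℂ) (t : Fin k → ℝ) :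
    EuclideanSpace ℂ (Fin n) :=
  act (NormedSpace.exp (∑ i, t i • M i)) 0

variable {k : ℕ} (M : Fin k → Matrix (Fin (n + 1)) (Fin (n + 1)) ℂ)

theorem expChart_zero : expChart M 0 = 0 := by
  ext i
  simp [expChart, act_zero, NormedSpace.exp_zero]

theorem expChart_smul (u : Fin k → ℝ) (s : ℝ) :
    expChart M (s • u) = act (NormedSpace.exp (s • ∑ i, u i • M i)) 0 := by
  simp [expChart, Finset.smul_sum, smul_smul]

theorem contDiffAt_expChart : ContDiffAt ℝ ∞ (expChart M) 0 := by
  refine (contDiffAt_piLp 2).2 fun i => ?_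
  simp only [expChart, act_zero, div_eq_mul_inv]
  exact (contDiff_exp_sum_smul_apply M i.succ 0).contDiffAt.mul
    ((contDiff_exp_sum_smul_apply M 0 0).contDiffAt.inv (by simp [NormedSpace.exp_zero]))

theorem fderiv_expChart (u : Fin k → ℝ) :
    fderiv ℝ (expChart M) 0 u = tangent (∑ i, u i • M i) := by
  have h1 : HasDerivAt (fun s : ℝ => expChart M (s • u)) (tangent (∑ i, u i • M i)) 0 := by
    simp only [expChart_smul]
    rw [← velocity_zero]
    exact hasDerivAt_act_exp (by simp [NormedSpace.exp_zero])
  have hl : HasDerivAt (fun s : ℝ => s • u) u 0 := by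
    simpa using (hasDerivAt_id (0 : ℝ)).smul_const u
  refine (HasFDerivAt.comp_hasDerivAt (l := expChart M) (f := fun s : ℝ => s • u) (0 : ℝ) ?_
    hl).unique h1
  rw [zero_smul]
  exact ((contDiffAt_expChart M).differentiableAt (by simp)).hasFDerivAt

/-- The chart sends lines through 0 to the curves `exp(sA) · o`, and the Christoffel term vanishes
at `o`. -/
theorem secondFundamentalForm_expChart (ν : EuclideanSpace ℂ (Fin n)) (u : Fin k → ℝ) :
    secondFundamentalForm metric (expChart M) 0 ν u u =
      metric 0 (acceleration (∑ i, u i • M i)) ν := by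
  have h : fderiv ℝ (fun s => fderiv ℝ (expChart M) s) 0 u u = acceleration (∑ i, u i • M i) := by
    refine fderiv_fderiv_apply_self (contDiffAt_expChart M) ?_ (hasDerivAt_velocity _)
    simp only [expChart_smul]
    filter_upwards [eventually_exp_apply_ne_zero (∑ i, u i • M i)] with s hs
    exact hasDerivAt_act_exp hs
  rw [secondFundamentalForm, expChart_zero, christoffel_metric_zero, h, add_zero]

/-- The mean curvature of an orbit, computed at the base point in an orthonormal basis `A` of the
Lie algebra. -/
theorem orbitHasMeanCurvature_of_orthonormal {ι : Type*} [Fintype ι] [DecidableEq ι]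
    {𝔥 : LieSubalgebra ℝ (su n)} {Y : su n} (A : ι → su n)
    (hspan : Submodule.span ℝ (Set.range A) = 𝔥.toSubmodule)
    (hA : ∀ i j, innerAN (A i) (A j) = if i = j then 1 else 0)
    (hY : ∀ i, innerAN Y (A i) = 0)
    (htr : ∀ ν, (∀ i, metric 0 (tangent (A i).1) ν = 0) →
      metric 0 (tangent Y.1) ν = ∑ i, metric 0 (acceleration (A i).1) ν) :
    OrbitHasMeanCurvature 𝔥 Y := by
  intro g _ k v
  have hinner : ∀ X X' : su n, innerAN X X' = metricForm 0 (tangent X.1) (tangent X'.1) :=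
    fun X X' => by rw [innerAN_eq, metricForm_apply, metric_zero_base]
  have hcomb : ∀ (c : ι → ℝ) (ν : EuclideanSpace ℂ (Fin n)),
      metric 0 (tangent (∑ i, c i • A i : su n).1) ν =
        ∑ i, c i * metric 0 (tangent (A i).1) ν := by
    intro c ν
    simp only [← metricForm_apply]
    have : (∑ i, c i • A i : su n).1 = ∑ i, c i • (A i).1 := by
      simp
    rw [this, map_sum, map_sum]
    simp
  -- Coefficients are recovered from tangent vectors alone. This yields both the independence of `A`
  -- and the immersion property of the orbit map.
  have hcoef : ∀ (c : ι → ℝ) (j : ι),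
      metric 0 (tangent (∑ i, c i • A i : su n).1) (tangent (A j).1) = c j := by
    intro c j
    rw [hcomb]
    have h : ∀ i, metric 0 (tangent (A i).1) (tangent (A j).1) = if i = j then 1 else 0 :=
      fun i => by rw [← hA i j, hinner, metricForm_apply]
    simp [h]
  have hz : ∀ ν, metric (0 : EuclideanSpace ℂ (Fin n)) 0 ν = 0 := fun ν => by simp [metric]
  have hli : LinearIndependent ℝ A := by
    refine Fintype.linearIndependent_iff.2 fun c hc j => ?_
    have h := hcoef c j
    rw [hc] at h
    rw [← h, ZeroMemClass.coe_zero, map_zero, hz]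
  have hmem : ∀ x : su n, x ∈ 𝔥 ↔ ∃ c : ι → ℝ, ∑ i, c i • A i = x := by
    intro x
    rw [← LieSubalgebra.mem_toSubmodule, ← hspan, Submodule.mem_span_range_iff_exists_fun]
  have hk : k = Fintype.card ι := by
    have h1 : Module.finrank ℝ 𝔥 = k := by simpa using Module.finrank_eq_card_basis v
    have h2 : Module.finrank ℝ 𝔥.toSubmodule = Fintype.card ι := by
      rw [← hspan, finrank_span_eq_card hli]
    exact h1.symm.trans h2
  have hAmem : ∀ i, A i ∈ 𝔥 := fun i => by
    rw [← LieSubalgebra.mem_toSubmodule, ← hspan]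
    exact Submodule.subset_span ⟨i, rfl⟩
  let σ : Fin k ≃ ι := Fintype.equivOfCardEq (by simpa using hk)
  let M : Fin k → Matrix (Fin (n + 1)) (Fin (n + 1)) ℂ := fun i => (v i).1.1
  have hM : ∀ u : Fin k → ℝ, ∑ i, u i • M i = (∑ i, u i • v i : 𝔥).1.1 := by
    intro u
    simp [M]
  have hzero : expChart M 0 = 0 := expChart_zero M
  have hchart : HasMeanCurvatureVector metric (expChart M) 0 (tangent Y.1) := by
    refine ⟨contDiffAt_expChart M, ?_, ?_, ?_⟩
    · refine (injective_iff_map_eq_zero _).2 fun u hu => ?_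
      rw [fderiv_expChart, hM] at hu
      obtain ⟨c, hc⟩ := (hmem _).1 (∑ i, u i • v i : 𝔥).2
      have hc0 : ∀ j, c j = 0 := fun j => by rw [← hcoef c j, hc, hu, hz]
      have h0 : (∑ i, u i • v i : 𝔥) = 0 := by
        apply Subtype.ext
        rw [← hc]
        simp [hc0]
      exact funext (Fintype.linearIndependent_iff.1 v.linearIndependent u h0)
    · intro u
      rw [hzero, fderiv_expChart, hM, metric_comm]
      obtain ⟨c, hc⟩ := (hmem _).1 (∑ i, u i • v i : 𝔥).2
      rw [← hc, hcomb]
      refine Finset.sum_eq_zero fun i _ => ?_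
      rw [metric_comm, ← metricForm_apply, ← hinner, hY, mul_zero]
    -- The basis `v` is arbitrary; the orthonormal frame consists of the coordinates of the `A i` in
    -- it.
    · let e : Fin k → Fin k → ℝ := fun i => v.repr ⟨A (σ i), hAmem _⟩
      have he : ∀ i, ∑ j, e i j • M j = (A (σ i)).1 := by
        intro i
        rw [hM, v.sum_repr]
      refine ⟨e, fun i j => ?_, fun ν hν => ?_⟩
      · rw [hzero, fderiv_expChart, fderiv_expChart, he, he, ← metricForm_apply, ← hinner, hA]
        simp
      · rw [hzero, htr, ← σ.sum_comp]
        · exact Finset.sum_congr rfl fun i _ => by rw [secondFundamentalForm_expChart, he]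
        · intro i
          have h := hν (e (σ.symm i))
          rwa [hzero, fderiv_expChart, he, Equiv.apply_symm_apply, metric_comm] at h
  have hact := hchart.act_comp g hzero
  rw [← leftInvariantVector_eq] at hact
  refine hact.congr_of_eventuallyEq ?_
  -- Near `t = 0` the denominator of `exp(...) · o` is nonzero, so the action is multiplicative
  -- there.
  have h0 : ∀ᶠ t : Fin k → ℝ in 𝓝 0, NormedSpace.exp (∑ l, t l • M l) 0 0 ≠ 0 :=
    (contDiff_exp_sum_smul_apply M 0 0).continuous.continuousAt.eventually_ne
      (by simp [NormedSpace.exp_zero])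
  filter_upwards [h0] with t ht
  refine act_mul ?_
  rw [basePoint, mulVec_cons_one, map_zero, add_zero]
  exact ht

end Orbit

/-! ### Structure of the root spaces and of the subalgebras built from them. -/

section RootSpaces

variable {n : ℕ}

theorem su_entry (A : su n) (i j : Fin (n + 1)) :
    (starRingEnd ℂ) (A.1 j i) * (Fin.cons (-1) fun _ => 1 : Fin (n + 1) → ℂ) j
      + (Fin.cons (-1) fun _ => 1 : Fin (n + 1) → ℂ) i * A.1 i j = 0 := by
  have h := congrFun (congrFun A.2.1 i) j
  simpa [form, Matrix.mul_diagonal, Matrix.diagonal_mul] using h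

theorem su_zero_succ (A : su n) (i : Fin n) : A.1 0 i.succ = (starRingEnd ℂ) (tangent A.1 i) := by
  have h := su_entry A 0 i.succ
  simp only [Fin.cons_succ, Fin.cons_zero] at h
  rw [tangent_apply]
  linear_combination -h

/-- Being Hermitian and being skew for the form are opposite conditions on the diagonal blocks, so
here and in `cartanP_succ_succ` these vanish. -/
theorem cartanP_zero_zero {B : su n} (hB : B ∈ cartanP n) : B.1 0 0 = 0 := by
  have h := su_entry B 0 0
  have h' : (starRingEnd ℂ) (B.1 0 0) = B.1 0 0 := congrFun (congrFun hB 0) 0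
  simp only [Fin.cons_zero, h'] at h
  linear_combination -(1 / 2) * h

theorem cartanP_succ_succ {B : su n} (hB : B ∈ cartanP n) (i j : Fin n) :
    B.1 i.succ j.succ = 0 := by
  have h := su_entry B i.succ j.succ
  have h' : (starRingEnd ℂ) (B.1 j.succ i.succ) = B.1 i.succ j.succ :=
    congrFun (congrFun hB i.succ) j.succ
  simp only [Fin.cons_succ, h'] at h
  linear_combination (1 / 2) * h

theorem mem_rootSpace {B A : su n} {c : ℝ} : A ∈ rootSpace B c ↔ ⁅B, A⁆ = c • A := by
  rw [rootSpace, Module.End.mem_eigenspace_iff, LieAlgebra.ad_apply]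

theorem rootSpace_entry {B A : su n} {c : ℝ} (hA : A ∈ rootSpace B c) (i j : Fin (n + 1)) :
    ∑ l, B.1 i l * A.1 l j - ∑ l, A.1 i l * B.1 l j = c * A.1 i j := by
  have h := congrArg (fun C : su n => C.1 i j) (mem_rootSpace.1 hA)
  simpa [Ring.lie_def, Matrix.mul_apply] using h

theorem inner_eq_sum (u v : EuclideanSpace ℂ (Fin n)) :
    inner ℂ u v = ∑ l, (starRingEnd ℂ) (u l) * v l := by
  simp [PiLp.inner_apply, mul_comm]

variable {B A : su n} {c : ℝ}

/-- This and the next two lemmas are the blocks of `[B, A] = cA`, where `B` has off-diagonal blocks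
`b`, `b*` only and `A` has first column `(x, y)` and lower block `D`: `cx = b*y - y*b`, `cD = by* -
yb*`, `cy = bx - Db`. -/
theorem rootSpace_zero_zero (hB : B ∈ cartanP n) (hA : A ∈ rootSpace B c) :
    c * A.1 0 0 = inner ℂ (tangent B.1) (tangent A.1) - inner ℂ (tangent A.1) (tangent B.1) := by
  rw [← rootSpace_entry hA, inner_eq_sum, inner_eq_sum, Fin.sum_univ_succ, Fin.sum_univ_succ,
    cartanP_zero_zero hB]
  simp only [su_zero_succ, ← tangent_apply]
  ring

theorem rootSpace_succ_succ (hB : B ∈ cartanP n) (hA : A ∈ rootSpace B c) (i j : Fin n) :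
    c * A.1 i.succ j.succ = tangent B.1 i * (starRingEnd ℂ) (tangent A.1 j)
      - tangent A.1 i * (starRingEnd ℂ) (tangent B.1 j) := by
  rw [← rootSpace_entry hA, Fin.sum_univ_succ, Fin.sum_univ_succ]
  simp only [cartanP_succ_succ hB, su_zero_succ, ← tangent_apply]
  simp

theorem rootSpace_succ_zero (hB : B ∈ cartanP n) (hA : A ∈ rootSpace B c) (i : Fin n) :
    c * tangent A.1 i = tangent B.1 i * A.1 0 0 - ∑ j, A.1 i.succ j.succ * tangent B.1 j := by
  rw [tangent_apply, ← rootSpace_entry hA, Fin.sum_univ_succ, Fin.sum_univ_succ]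
  simp only [cartanP_succ_succ hB, cartanP_zero_zero hB, ← tangent_apply]
  simp

/-- For `c ≠ 0` the block equations express the diagonal blocks through the first column, so a root
vector is determined by its tangent vector. -/
theorem eq_zero_of_tangent_eq_zero (hB : B ∈ cartanP n) (hc : c ≠ 0) (hA : A ∈ rootSpace B c)
    (h : tangent A.1 = 0) : A = 0 := by
  have hc' : (c : ℂ) ≠ 0 := by exact_mod_cast hc
  apply Subtype.ext
  ext i j
  refine Fin.cases ?_ (fun i => ?_) i <;> refine Fin.cases ?_ (fun j => ?_) j
  · have h1 := rootSpace_zero_zero hB hA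
    simpa [h, hc'] using h1
  · simp [su_zero_succ, h]
  · simp [← tangent_apply, h]
  · have h1 := rootSpace_succ_succ hB hA i j
    simpa [h, hc'] using h1

theorem eq_of_tangent_eq (hB : B ∈ cartanP n) (hc : c ≠ 0) {A A' : su n} (hA : A ∈ rootSpace B c)
    (hA' : A' ∈ rootSpace B c) (h : tangent A.1 = tangent A'.1) : A = A' := by
  refine sub_eq_zero.1 (eq_zero_of_tangent_eq_zero hB hc (Submodule.sub_mem _ hA hA') ?_)
  rw [AddSubgroupClass.coe_sub, map_sub, h, sub_self]

theorem inner_tangent_self (hB1 : innerAN B B = 1) :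
    inner ℂ (tangent B.1) (tangent B.1) = (1 / 4 : ℂ) := by
  rw [innerAN_eq, inner_self_eq_norm_sq_to_K] at hB1
  rw [inner_self_eq_norm_sq_to_K]
  have h : ‖tangent B.1‖ ^ 2 = 1 / 4 := by
    have h' : 4 * ‖tangent B.1‖ ^ 2 = 1 := by
      rw [← hB1]; norm_cast
    linarith
  calc ((‖tangent B.1‖ : ℝ) : ℂ) ^ 2 = ((‖tangent B.1‖ ^ 2 : ℝ) : ℂ) := by push_cast; rfl
    _ = 1 / 4 := by rw [h]; norm_num

/-- Multiplying `cy = bx - Db` by `c` and eliminating `cx` and `cD` leaves an equation in `y` alone;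
the constant is `‖b‖² = 1/4`, since the metric at `o` is 4 times the Euclidean one. -/
theorem rootSpace_tangent (hB : B ∈ cartanP n) (hB1 : innerAN B B = 1) (hA : A ∈ rootSpace B c) :
    ((c : ℂ) ^ 2 - 1 / 4) • tangent A.1 = (inner ℂ (tangent B.1) (tangent A.1)
      - 2 * inner ℂ (tangent A.1) (tangent B.1)) • tangent B.1 := by
  ext i
  have h1 := rootSpace_succ_zero hB hA i
  have h2 := rootSpace_zero_zero hB hA
  have h3 : (c : ℂ) * ∑ j, A.1 i.succ j.succ * tangent B.1 j =
      tangent B.1 i * inner ℂ (tangent A.1) (tangent B.1) - tangent A.1 i * (1 / 4) := by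
    rw [← inner_tangent_self hB1, inner_eq_sum, inner_eq_sum, Finset.mul_sum, Finset.mul_sum,
      Finset.mul_sum, ← Finset.sum_sub_distrib]
    refine Finset.sum_congr rfl fun j _ => ?_
    rw [← mul_assoc, rootSpace_succ_succ hB hA]
    ring
  simp only [PiLp.smul_apply, smul_eq_mul]
  linear_combination c * h1 + tangent B.1 i * h2 - h3

theorem inner_tangent_eq (hB : B ∈ cartanP n) (hB1 : innerAN B B = 1) (hA : A ∈ rootSpace B c) :
    ((c : ℂ) ^ 2 - 1 / 4) * inner ℂ (tangent B.1) (tangent A.1) =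
      (inner ℂ (tangent B.1) (tangent A.1)
        - 2 * (starRingEnd ℂ) (inner ℂ (tangent B.1) (tangent A.1))) * (1 / 4) := by
  have h := congrArg (inner ℂ (tangent B.1)) (rootSpace_tangent hB hB1 hA)
  rwa [inner_smul_right, inner_smul_right, inner_tangent_self hB1,
    ← inner_conj_symm (tangent A.1)] at h

/-- With `P = ⟨b, y⟩`, pairing the equation for `y` with `b` gives `(c² - 1/4)P = (P - 2P̄)/4`. Its
real part is `c² Re P = 0` and its imaginary part `(c² - 1) Im P = 0`. -/
theorem re_inner_tangent (hB : B ∈ cartanP n) (hB1 : innerAN B B = 1) (hc : c ≠ 0)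
    (hA : A ∈ rootSpace B c) : (inner ℂ (tangent B.1) (tangent A.1)).re = 0 := by
  have h := congrArg Complex.re (inner_tangent_eq hB hB1 hA)
  generalize inner ℂ (tangent B.1) (tangent A.1) = P at h ⊢
  have h' : c ^ 2 * P.re = 0 := by
    simp [pow_two] at h
    linarith
  simpa [hc] using h'

theorem im_inner_tangent (hB : B ∈ cartanP n) (hB1 : innerAN B B = 1) (hc : c ^ 2 ≠ 1)
    (hA : A ∈ rootSpace B c) : (inner ℂ (tangent B.1) (tangent A.1)).im = 0 := by
  have h := congrArg Complex.im (inner_tangent_eq hB hB1 hA)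
  generalize inner ℂ (tangent B.1) (tangent A.1) = P at h ⊢
  have h' : (c ^ 2 - 1) * P.im = 0 := by
    simp [pow_two] at h
    linarith
  simpa [sub_eq_zero, hc] using h'

theorem inner_tangent_eq_zero (hB : B ∈ cartanP n) (hB1 : innerAN B B = 1) (hc : c ≠ 0)
    (hc1 : c ^ 2 ≠ 1) (hA : A ∈ rootSpace B c) : inner ℂ (tangent B.1) (tangent A.1) = 0 :=
  Complex.ext (re_inner_tangent hB hB1 hc hA) (im_inner_tangent hB hB1 hc1 hA)

theorem inner_tangent_half (hB : B ∈ cartanP n) (hB1 : innerAN B B = 1)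
    (hA : A ∈ rootSpace B (1 / 2)) : inner ℂ (tangent B.1) (tangent A.1) = 0 :=
  inner_tangent_eq_zero hB hB1 (by norm_num) (by norm_num) hA

/-- Here `P = 0` and `c² ≠ 1/4`, so `y = 0`. Applied with `c = 3/2` and `c = 2`, this kills the
brackets of `g_{2α}` with `g_α` and with itself. -/
theorem eq_zero_of_mem_rootSpace (hB : B ∈ cartanP n) (hB1 : innerAN B B = 1) (hc : 1 < c)
    (hA : A ∈ rootSpace B c) : A = 0 := by
  have hP := inner_tangent_eq_zero hB hB1 (by linarith) (by nlinarith) hA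
  have h := rootSpace_tangent hB hB1 hA
  rw [← inner_conj_symm (tangent A.1), hP] at h
  have hc' : (c : ℂ) ^ 2 - 1 / 4 ≠ 0 := by
    have h4 : c ^ 2 - 1 / 4 ≠ 0 := by nlinarith
    intro h0
    refine h4 (Complex.ofReal_injective ?_)
    push_cast
    exact h0
  have h' : tangent A.1 = 0 := (smul_eq_zero.1 (h.trans (by simp))).resolve_left hc'
  exact eq_zero_of_tangent_eq_zero hB (by linarith) hA h'

theorem tangent_of_mem_rootSpace_one (hB : B ∈ cartanP n) (hB1 : innerAN B B = 1)
    (hA : A ∈ rootSpace B 1) : ∃ r : ℝ, tangent A.1 = r • (Complex.I • tangent B.1) := by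
  have h := rootSpace_tangent hB hB1 hA
  have hre := re_inner_tangent hB hB1 one_ne_zero hA
  rw [← inner_conj_symm (tangent A.1)] at h
  generalize inner ℂ (tangent B.1) (tangent A.1) = P at h hre
  refine ⟨4 * P.im, ?_⟩
  have hP : P - 2 * (starRingEnd ℂ) P = 3 * (P.im * Complex.I) := by
    apply Complex.ext
    · simp [hre]
    · simp; ring
  rw [hP] at h
  ext i
  have hi := congrArg (fun x : EuclideanSpace ℂ (Fin n) => x i) h
  simp only [PiLp.smul_apply, smul_eq_mul, Complex.real_smul] at hi ⊢
  push_cast at hi ⊢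
  linear_combination (4 / 3) * hi

theorem lie_mem_rootSpace {A A' : su n} {c c' : ℝ} (hA : A ∈ rootSpace B c)
    (hA' : A' ∈ rootSpace B c') : ⁅A, A'⁆ ∈ rootSpace B (c + c') := by
  rw [mem_rootSpace] at *
  rw [leibniz_lie, hA, hA', smul_lie, lie_smul, add_smul]

/-- The subspaces `ℝ(aB + X) ⊕ 𝔴 ⊕ 𝔤_{2α}` are Lie subalgebras. -/
theorem exists_lieSubalgebra (hB : B ∈ cartanP n) (hB1 : innerAN B B = 1)
    {w : Submodule ℝ (su n)} (hw : w ≤ rootSpace B (1 / 2)) (a : ℝ) {X : su n}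
    (hX : X ∈ rootSpace B (1 / 2)) :
    ∃ 𝔥 : LieSubalgebra ℝ (su n),
      𝔥.toSubmodule = Submodule.span ℝ {a • B + X} ⊔ w ⊔ rootSpace B 1 := by
  have hYY : ∀ Y ∈ rootSpace B (1 / 2), ∀ Y' ∈ rootSpace B (1 / 2), ⁅Y, Y'⁆ ∈ rootSpace B 1 := by
    intro Y hY Y' hY'
    have := lie_mem_rootSpace hY hY'
    norm_num at this
    exact this
  have hYZ : ∀ Y ∈ rootSpace B (1 / 2), ∀ Z ∈ rootSpace B 1, ⁅Y, Z⁆ = 0 := fun Y hY Z hZ =>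
    eq_zero_of_mem_rootSpace hB hB1 (by norm_num) (lie_mem_rootSpace hY hZ)
  have hZZ : ∀ Z ∈ rootSpace B 1, ∀ Z' ∈ rootSpace B 1, ⁅Z, Z'⁆ = 0 := fun Z hZ Z' hZ' =>
    eq_zero_of_mem_rootSpace hB hB1 (by norm_num) (lie_mem_rootSpace hZ hZ')
  have hZY : ∀ Y ∈ rootSpace B (1 / 2), ∀ Z ∈ rootSpace B 1, ⁅Z, Y⁆ = 0 := fun Y hY Z hZ => by
    rw [← lie_skew, hYZ Y hY Z hZ, neg_zero]
  have hTY : ∀ Y ∈ rootSpace B (1 / 2), ⁅a • B + X, Y⁆ = (a / 2) • Y + ⁅X, Y⁆ := fun Y hY => by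
    rw [add_lie, smul_lie, mem_rootSpace.1 hY, smul_smul, mul_one_div]
  have hTZ : ∀ Z ∈ rootSpace B 1, ⁅a • B + X, Z⁆ = a • Z := fun Z hZ => by
    rw [add_lie, smul_lie, mem_rootSpace.1 hZ, hYZ X hX Z hZ, one_smul, add_zero]
  generalize a • B + X = T at hTY hTZ ⊢
  refine ⟨{ toSubmodule := Submodule.span ℝ {T} ⊔ w ⊔ rootSpace B 1, lie_mem' := ?_ }, rfl⟩
  intro x y hx hy
  obtain ⟨x₁, hx₁, Z, hZ, rfl⟩ := Submodule.mem_sup.1 hx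
  obtain ⟨x₂, hx₂, W, hW, rfl⟩ := Submodule.mem_sup.1 hx₁
  obtain ⟨s, rfl⟩ := Submodule.mem_span_singleton.1 hx₂
  obtain ⟨y₁, hy₁, Z', hZ', rfl⟩ := Submodule.mem_sup.1 hy
  obtain ⟨y₂, hy₂, W', hW', rfl⟩ := Submodule.mem_sup.1 hy₁
  obtain ⟨s', rfl⟩ := Submodule.mem_span_singleton.1 hy₂
  -- The bracket is grouped into a part in `w`, coming from `[aB, W] = (a/2)W`, and a part in
  -- `g_{2α}`, which contains all brackets of `g_α` with itself.
  have key : ⁅s • T + W + Z, s' • T + W' + Z'⁆ =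
      ((s * (a / 2)) • W' - (s' * (a / 2)) • W)
        + (s • ⁅X, W'⁆ - s' • ⁅X, W⁆ + ⁅W, W'⁆ + (s * a) • Z' - (s' * a) • Z) := by
    have hWT : ⁅W, T⁆ = -((a / 2) • W + ⁅X, W⁆) := by rw [← hTY W (hw hW), lie_skew]
    have hZT : ⁅Z, T⁆ = -(a • Z) := by rw [← hTZ Z hZ, lie_skew]
    simp only [add_lie, lie_add, smul_lie, lie_smul, lie_self,
      hYZ W (hw hW) Z' hZ', hZY W' (hw hW') Z hZ, hZZ Z hZ Z' hZ',
      hTY W' (hw hW'), hTZ Z' hZ', hWT, hZT]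
    module
  change ⁅s • T + W + Z, s' • T + W' + Z'⁆ ∈ _
  rw [key]
  refine Submodule.add_mem _ ?_ ?_
  · exact Submodule.mem_sup_left (Submodule.mem_sup_right
      (w.sub_mem (w.smul_mem _ hW') (w.smul_mem _ hW)))
  · refine Submodule.mem_sup_right ?_
    have h1 := hYY X hX W' (hw hW')
    have h2 := hYY X hX W (hw hW)
    have h3 := hYY W (hw hW) W' (hw hW')
    exact Submodule.sub_mem _ (Submodule.add_mem _ (Submodule.add_mem _ (Submodule.sub_mem _
      (Submodule.smul_mem _ _ h1) (Submodule.smul_mem _ _ h2)) h3) (Submodule.smul_mem _ _ hZ'))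
      (Submodule.smul_mem _ _ hZ)

/-- The unit vector of `𝔤_{2α}` whose tangent vector is the image of `B` under the complex
structure. -/
theorem exists_mem_rootSpace_one (hB : B ∈ cartanP n) (hB1 : innerAN B B = 1) :
    ∃ Z ∈ rootSpace B 1, tangent Z.1 = Complex.I • tangent B.1 := by
  -- `ξ = (1, 2b)` is a null vector of the form and an eigenvector of `B` for `1/2`. With `J` the
  -- matrix of the form, `BJ = -JB` gives `[B, ξξ*J] = ξξ*J`, nullity gives trace zero, and the
  -- factor `-i/2` makes the matrix skew for the form with tangent vector `ib`.
  let ξ : Fin (n + 1) → ℂ := Fin.cons 1 ((2 : ℂ) • tangent B.1).ofLp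
  let V : Matrix (Fin (n + 1)) (Fin (n + 1)) ℂ := Matrix.vecMulVec ξ (star ξ)
  have hBξ : B.1 *ᵥ ξ = (1 / 2 : ℂ) • ξ := by
    ext i
    refine Fin.cases ?_ (fun i => ?_) i
    · have h : ∑ j, B.1 0 j.succ * (2 * tangent B.1 j) = 2 * (1 / 4) := by
        rw [← inner_tangent_self hB1, inner_eq_sum, Finset.mul_sum]
        refine Finset.sum_congr rfl fun j _ => ?_
        rw [su_zero_succ]
        ring
      simp [ξ, Matrix.mulVec, dotProduct, Fin.sum_univ_succ, cartanP_zero_zero hB] at h ⊢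
      rw [h]
      norm_num
    · simp [ξ, Matrix.mulVec, dotProduct, Fin.sum_univ_succ, cartanP_succ_succ hB, tangent_apply]
  have hV : Vᴴ = V := by simp [V, Matrix.conjTranspose_vecMulVec]
  have hJ : (form n)ᴴ = form n := by
    rw [form, Matrix.diagonal_conjTranspose]
    congr 1
    ext i
    refine Fin.cases ?_ (fun i => ?_) i <;> simp
  have hBV : B.1 * V = (1 / 2 : ℂ) • V := by
    simp only [V, Matrix.mul_vecMulVec, hBξ, Matrix.smul_vecMulVec]
  have hBh : B.1ᴴ = B.1 := hB
  have hVB : V * B.1 = (1 / 2 : ℂ) • V := by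
    have h := congrArg Matrix.conjTranspose hBV
    rw [Matrix.conjTranspose_mul, hV, hBh, Matrix.conjTranspose_smul, hV] at h
    simpa using h
  have hJB : form n * B.1 = -(B.1 * form n) := by
    have h := B.2.1
    rw [hBh] at h
    exact eq_neg_of_add_eq_zero_right h
  have htr : (V * form n).trace = 0 := by
    have h : (V * form n).trace = herm ξ ξ := by
      simp only [V, herm, Matrix.vecMulVec_mul, Matrix.trace_vecMulVec, Matrix.dotProduct_mulVec]
      exact dotProduct_comm _ _
    rw [h]
    simp only [ξ]
    rw [herm_cons, inner_smul_left, inner_smul_right, inner_tangent_self hB1,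
      map_ofNat, map_one]
    norm_num
  let Z : su n := ⟨(-(Complex.I / 2)) • (V * form n), by
    refine ⟨?_, by rw [Matrix.trace_smul, htr, smul_zero]⟩
    rw [Matrix.conjTranspose_smul, Matrix.conjTranspose_mul, hV, hJ, Matrix.smul_mul,
      Matrix.mul_smul, ← Matrix.mul_assoc, ← add_smul]
    simp [neg_div]⟩
  refine ⟨Z, mem_rootSpace.2 (Subtype.ext ?_), ?_⟩
  · change B.1 * ((-(Complex.I / 2)) • (V * form n)) - ((-(Complex.I / 2)) • (V * form n)) * B.1 =
      (1 : ℝ) • ((-(Complex.I / 2)) • (V * form n))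
    rw [Matrix.mul_smul, Matrix.smul_mul, ← Matrix.mul_assoc, hBV, Matrix.mul_assoc V, hJB,
      Matrix.mul_neg, ← Matrix.mul_assoc, hVB, Matrix.smul_mul]
    module
  · ext i
    simp [Z, V, ξ, tangent_apply, form, Matrix.vecMulVec_apply]
    ring

theorem rootSpace_one_eq_span (hB : B ∈ cartanP n) (hB1 : innerAN B B = 1) {Z : su n}
    (hZ : Z ∈ rootSpace B 1) (hZt : tangent Z.1 = Complex.I • tangent B.1) :
    rootSpace B 1 = Submodule.span ℝ {Z} := by
  refine le_antisymm (fun A hA => ?_) ?_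
  · obtain ⟨r, hr⟩ := tangent_of_mem_rootSpace_one hB hB1 hA
    refine Submodule.mem_span_singleton.2 ⟨r, ?_⟩
    refine eq_of_tangent_eq hB one_ne_zero (Submodule.smul_mem _ _ hZ) hA ?_
    rw [hr, ← hZt]
    exact map_smul tangent r Z.1
  · rw [Submodule.span_singleton_le_iff_mem]
    exact hZ

end RootSpaces

/-! ### Accelerations of the root vectors. -/

section Acceleration

variable {n : ℕ} {B : su n}

theorem acceleration_apply (A : Matrix (Fin (n + 1)) (Fin (n + 1)) ℂ) (i : Fin n) :
    acceleration A i = ∑ j, A i.succ j.succ * tangent A j - tangent A i * A 0 0 := by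
  simp only [acceleration, Matrix.mul_apply, Fin.sum_univ_succ, tangent_apply]
  ring

/-- With `y` the tangent vector of `X`, orthogonality to `b` gives `x = 0` and `D = 2(by* - yb*)`,
so the acceleration is `D(ab + y) = 2‖y‖² b - (a/2)y`, and `innerAN X X = 4‖y‖²`. -/
theorem acceleration_half (hB : B ∈ cartanP n) (hB1 : innerAN B B = 1) (a : ℝ) {X : su n}
    (hX : X ∈ rootSpace B (1 / 2)) :
    acceleration (a • B + X).1 =
      (innerAN X X / 2) • tangent B.1 - (a / 2) • tangent X.1 := by
  have h0 := inner_tangent_half hB hB1 hX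
  have h0' : inner ℂ (tangent X.1) (tangent B.1) = 0 := by rw [← inner_conj_symm, h0, map_zero]
  have h00 : X.1 0 0 = 0 := by
    have h := rootSpace_zero_zero hB hX
    rw [h0, h0'] at h
    simpa using h
  have hXX : (innerAN X X : ℂ) = 4 * inner ℂ (tangent X.1) (tangent X.1) := by
    have h : inner ℂ (tangent X.1) (tangent X.1) = ((‖tangent X.1‖ ^ 2 : ℝ) : ℂ) := by
      rw [inner_self_eq_norm_sq_to_K]
      push_cast
      rfl
    rw [innerAN_eq, h, Complex.ofReal_re]
    push_cast
    rfl
  have hM : ∀ i j : Fin n, X.1 i.succ j.succ = 2 * (tangent B.1 i * (starRingEnd ℂ) (tangent X.1 j)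
      - tangent X.1 i * (starRingEnd ℂ) (tangent B.1 j)) := by
    intro i j
    rw [← rootSpace_succ_succ hB hX i j]
    push_cast
    ring
  have hadd : (a • B + X).1 = a • B.1 + X.1 := rfl
  ext i
  have hs : ∑ j, X.1 i.succ j.succ * (a * tangent B.1 j + tangent X.1 j) =
      2 * (tangent B.1 i * (a * inner ℂ (tangent X.1) (tangent B.1)
          + inner ℂ (tangent X.1) (tangent X.1))
        - tangent X.1 i * (a * inner ℂ (tangent B.1) (tangent B.1)
          + inner ℂ (tangent B.1) (tangent X.1))) := by
    simp only [inner_eq_sum, Finset.mul_sum, ← Finset.sum_add_distrib, ← Finset.sum_sub_distrib]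
    refine Finset.sum_congr rfl fun j _ => ?_
    rw [hM]
    ring
  rw [h0, h0', inner_tangent_self hB1] at hs
  rw [acceleration_apply, hadd, map_add, map_smul]
  simp only [Matrix.add_apply, Matrix.smul_apply, cartanP_succ_succ hB, cartanP_zero_zero hB, h00,
    PiLp.add_apply, PiLp.sub_apply, PiLp.smul_apply, Complex.real_smul, mul_zero, zero_add,
    add_zero, sub_zero, hs]
  push_cast
  rw [hXX]
  ring

/-- Here `x = i/2` and `D = -2i bb*`; the terms `D(ib)` and `-(ib)x` each contribute `b/2`. -/
theorem acceleration_one (hB : B ∈ cartanP n) (hB1 : innerAN B B = 1) {Z : su n}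
    (hZ : Z ∈ rootSpace B 1) (hZt : tangent Z.1 = Complex.I • tangent B.1) :
    acceleration Z.1 = tangent B.1 := by
  have h00 := rootSpace_zero_zero hB hZ
  have hM := rootSpace_succ_succ hB hZ
  rw [hZt, inner_smul_left, inner_smul_right, inner_tangent_self hB1] at h00
  rw [hZt] at hM
  simp only [Complex.ofReal_one, one_mul, PiLp.smul_apply, smul_eq_mul] at h00 hM
  ext i
  have hs : ∑ j, Z.1 i.succ j.succ * (Complex.I * tangent B.1 j) =
      2 * tangent B.1 i * inner ℂ (tangent B.1) (tangent B.1) := by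
    simp only [inner_eq_sum, Finset.mul_sum]
    refine Finset.sum_congr rfl fun j _ => ?_
    rw [hM]
    simp only [map_mul, Complex.conj_I]
    linear_combination (-2 * tangent B.1 i * (starRingEnd ℂ) (tangent B.1 j) * tangent B.1 j)
      * Complex.I_sq
  rw [inner_tangent_self hB1] at hs
  rw [acceleration_apply, hZt]
  simp only [PiLp.smul_apply, smul_eq_mul, hs, h00, Complex.conj_I]
  linear_combination (-(1 / 2) * tangent B.1 i) * Complex.I_sq

end Acceleration

/-! ### The inner product on the Lie algebra and orthonormal bases of `w`. -/

section InnerProduct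

variable {n : ℕ}

theorem innerAN_comm (Y Y' : su n) : innerAN Y Y' = innerAN Y' Y := metric_comm _ _ _

theorem innerAN_eq_metric (Y Y' : su n) :
    innerAN Y Y' = metric 0 (tangent Y.1) (tangent Y'.1) := by
  rw [innerAN_eq, metric_zero_base]

theorem innerAN_add_left (Y Y' Y'' : su n) :
    innerAN (Y + Y') Y'' = innerAN Y Y'' + innerAN Y' Y'' := by
  simp only [innerAN_eq_metric, AddMemClass.coe_add, map_add, metric_add_left]

theorem innerAN_smul_left (c : ℝ) (Y Y' : su n) : innerAN (c • Y) Y' = c * innerAN Y Y' := by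
  simp only [innerAN_eq_metric, SetLike.val_smul, map_smul, metric_smul_left]

theorem innerAN_add_right (Y Y' Y'' : su n) :
    innerAN Y (Y' + Y'') = innerAN Y Y' + innerAN Y Y'' := by
  simp only [innerAN_comm Y, innerAN_add_left]

theorem innerAN_smul_right (c : ℝ) (Y Y' : su n) : innerAN Y (c • Y') = c * innerAN Y Y' := by
  simp only [innerAN_comm Y, innerAN_smul_left]

theorem innerAN_zero_left (Y : su n) : innerAN 0 Y = 0 := by
  simpa using innerAN_smul_left 0 0 Y

theorem innerAN_self (Y : su n) : innerAN Y Y = 4 * ‖tangent Y.1‖ ^ 2 := by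
  rw [innerAN_eq, inner_self_eq_norm_sq_to_K]
  norm_cast

theorem innerAN_self_nonneg (Y : su n) : 0 ≤ innerAN Y Y := by
  rw [innerAN_self]
  positivity

theorem tangent_eq_zero_of_innerAN_self {Y : su n} (h : innerAN Y Y = 0) : tangent Y.1 = 0 := by
  rw [innerAN_self] at h
  simpa using h

variable {B : su n}

theorem exists_orthonormal_family (hB : B ∈ cartanP n) {w : Submodule ℝ (su n)}
    (hw : w ≤ rootSpace B (1 / 2)) :
    ∃ W : Fin (Module.finrank ℝ w) → su n, (∀ i, W i ∈ w) ∧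
      Submodule.span ℝ (Set.range W) = w ∧
      ∀ i j, innerAN (W i) (W j) = if i = j then 1 else 0 := by
  -- On all of `su n` the form `innerAN` is only semidefinite; it is definite on `w` because root
  -- vectors are determined by their tangent vectors.
  let core : InnerProductSpace.Core ℝ w :=
    { inner := fun x y => innerAN x.1 y.1
      conj_inner_symm := fun x y => innerAN_comm _ _
      re_inner_nonneg := fun x => innerAN_self_nonneg _
      add_left := fun x y z => innerAN_add_left _ _ _
      smul_left := fun x y c => innerAN_smul_left _ _ _
      definite := fun x hx => Subtype.ext (eq_zero_of_tangent_eq_zero hB (by norm_num) (hw x.2)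
        (tangent_eq_zero_of_innerAN_self hx)) }
  let _ : NormedAddCommGroup w := core.toNormedAddCommGroup
  let _ : InnerProductSpace ℝ w := InnerProductSpace.ofCore core.toCore
  let b := stdOrthonormalBasis ℝ w
  refine ⟨fun i => (b i).1, fun i => (b i).2, ?_, fun i j => ?_⟩
  · have h := congrArg (Submodule.map w.subtype) b.toBasis.span_eq
    rw [Submodule.map_span, Submodule.map_top, Submodule.range_subtype, ← Set.range_comp] at h
    simpa [Function.comp_def] using h
  · exact orthonormal_iff_ite.1 b.orthonormal i j

theorem innerAN_half (hB : B ∈ cartanP n) (hB1 : innerAN B B = 1) {Y : su n}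
    (hY : Y ∈ rootSpace B (1 / 2)) : innerAN B Y = 0 := by
  rw [innerAN_eq, inner_tangent_half hB hB1 hY, Complex.zero_re, mul_zero]

theorem innerAN_one (hB : B ∈ cartanP n) (hB1 : innerAN B B = 1) {Z : su n}
    (hZ : Z ∈ rootSpace B 1) : innerAN B Z = 0 := by
  rw [innerAN_eq, re_inner_tangent hB hB1 one_ne_zero hZ, mul_zero]

theorem innerAN_half_one (hB : B ∈ cartanP n) (hB1 : innerAN B B = 1) {Y Z : su n}
    (hY : Y ∈ rootSpace B (1 / 2)) (hZt : tangent Z.1 = Complex.I • tangent B.1) :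
    innerAN Z Y = 0 := by
  rw [innerAN_eq, hZt, inner_smul_left, inner_tangent_half hB hB1 hY, mul_zero, Complex.zero_re,
    mul_zero]

theorem innerAN_one_self (hB1 : innerAN B B = 1) {Z : su n}
    (hZt : tangent Z.1 = Complex.I • tangent B.1) : innerAN Z Z = 1 := by
  rw [innerAN_self] at *
  rw [hZt, norm_smul, Complex.norm_I, one_mul, hB1]

end InnerProduct

/-! ### Summation over orthonormal bases. -/

section MeanCurvature

variable {n : ℕ} {B : su n}

theorem metric_acceleration_half (hB : B ∈ cartanP n) (hB1 : innerAN B B = 1) (a : ℝ) {X : su n}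
    (hX : X ∈ rootSpace B (1 / 2)) (ν : EuclideanSpace ℂ (Fin n)) :
    metric 0 (acceleration (a • B + X).1) ν =
      innerAN X X / 2 * metric 0 (tangent B.1) ν - a / 2 * metric 0 (tangent X.1) ν := by
  rw [acceleration_half hB hB1 a hX, sub_eq_add_neg, ← neg_smul, metric_add_left, metric_smul_left,
    metric_smul_left]
  ring

theorem metric_acceleration_of_unit (hB : B ∈ cartanP n) (hB1 : innerAN B B = 1) {Y : su n}
    (hY : Y ∈ rootSpace B (1 / 2)) (hY1 : innerAN Y Y = 1) (ν : EuclideanSpace ℂ (Fin n)) :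
    metric 0 (acceleration Y.1) ν = 1 / 2 * metric 0 (tangent B.1) ν := by
  have h := metric_acceleration_half hB hB1 0 hY ν
  rw [zero_smul, zero_add, hY1] at h
  rw [h]
  ring

/-- The mean curvature of the orbit with Lie algebra `𝔴 ⊕ 𝔤_{2α}`. -/
theorem orbitHasMeanCurvature_nilpotent (hB : B ∈ cartanP n) (hB1 : innerAN B B = 1)
    {w : Submodule ℝ (su n)} (hw : w ≤ rootSpace B (1 / 2)) {𝔥 : LieSubalgebra ℝ (su n)}
    (h𝔥 : 𝔥.toSubmodule = w ⊔ rootSpace B 1) :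
    OrbitHasMeanCurvature 𝔥 (((2 + Module.finrank ℝ w : ℝ) / 2) • B) := by
  obtain ⟨Z, hZ, hZt⟩ := exists_mem_rootSpace_one hB hB1
  obtain ⟨W, hWw, hWspan, hW⟩ := exists_orthonormal_family hB hw
  have hWZ : ∀ i, innerAN Z (W i) = 0 := fun i => innerAN_half_one hB hB1 (hw (hWw i)) hZt
  let A : Option (Fin (Module.finrank ℝ w)) → su n := fun o => o.elim Z W
  refine orbitHasMeanCurvature_of_orthonormal A ?_ ?_ ?_ ?_
  · rw [h𝔥, Option.range_eq, Submodule.span_insert, rootSpace_one_eq_span hB hB1 hZ hZt, sup_comm]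
    change Submodule.span ℝ (Set.range W) ⊔ _ = _
    rw [hWspan]
    rfl
  · rintro (_ | i) (_ | j)
    · simpa [A] using innerAN_one_self hB1 hZt
    · simpa [A] using hWZ j
    · simpa [A, innerAN_comm (W i)] using hWZ i
    · simpa [A] using hW i j
  · rintro (_ | i)
    · simp [A, innerAN_smul_left, innerAN_one hB hB1 hZ]
    · simp [A, innerAN_smul_left, innerAN_half hB hB1 (hw (hWw i))]
  · intro ν _
    have hs : ∀ i, metric 0 (acceleration (W i).1) ν = 1 / 2 * metric 0 (tangent B.1) ν := fun i =>
      metric_acceleration_of_unit hB hB1 (hw (hWw i)) (by simp [hW]) ν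
    rw [Fintype.sum_option]
    simp only [A, Option.elim_none, Option.elim_some, hs, acceleration_one hB hB1 hZ hZt,
      SetLike.val_smul, map_smul, metric_smul_left, Finset.sum_const, Finset.card_univ,
      Fintype.card_fin, nsmul_eq_mul]
    ring

/-- The mean curvature of the orbit with Lie algebra `ℝ(aB + X) ⊕ 𝔴 ⊕ 𝔤_{2α}`. -/
theorem orbitHasMeanCurvature_solvable (hB : B ∈ cartanP n) (hB1 : innerAN B B = 1)
    {w : Submodule ℝ (su n)} (hw : w ≤ rootSpace B (1 / 2)) {a : ℝ} (ha : a ≠ 0) {X : su n}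
    (hX : X ∈ rootSpace B (1 / 2)) (hXw : ∀ W ∈ w, innerAN X W = 0)
    {𝔥 : LieSubalgebra ℝ (su n)}
    (h𝔥 : 𝔥.toSubmodule = Submodule.span ℝ {a • B + X} ⊔ w ⊔ rootSpace B 1) :
    OrbitHasMeanCurvature 𝔥
      (((3 + Module.finrank ℝ w : ℝ) / (2 * (a ^ 2 + innerAN X X))) •
        (innerAN X X • B - a • X)) := by
  obtain ⟨Z, hZ, hZt⟩ := exists_mem_rootSpace_one hB hB1
  obtain ⟨W, hWw, hWspan, hW⟩ := exists_orthonormal_family hB hw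
  have hWZ : ∀ i, innerAN Z (W i) = 0 := fun i => innerAN_half_one hB hB1 (hw (hWw i)) hZt
  have hN : 0 < a ^ 2 + innerAN X X := by
    have h1 := innerAN_self_nonneg X
    have h2 := sq_pos_of_ne_zero ha
    linarith
  -- `r` normalizes `aB + X`, as `B` is a unit vector orthogonal to `X`.
  obtain ⟨r, hr0, hr⟩ : ∃ r : ℝ, r ≠ 0 ∧ r ^ 2 * (a ^ 2 + innerAN X X) = 1 := by
    refine ⟨(√(a ^ 2 + innerAN X X))⁻¹, inv_ne_zero (Real.sqrt_pos.2 hN).ne', ?_⟩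
    rw [inv_pow, Real.sq_sqrt hN.le, inv_mul_cancel₀ hN.ne']
  have hBX := innerAN_half hB hB1 hX
  have hBZ := innerAN_one hB hB1 hZ
  have hZX := innerAN_half_one hB hB1 hX hZt
  have hBW : ∀ i, innerAN B (W i) = 0 := fun i => innerAN_half hB hB1 (hw (hWw i))
  have hXW : ∀ i, innerAN X (W i) = 0 := fun i => hXw _ (hWw i)
  have hTZ : innerAN (r • (a • B + X)) Z = 0 := by
    rw [innerAN_smul_left, innerAN_add_left, innerAN_smul_left, hBZ, innerAN_comm X, hZX]
    ring
  have hTW : ∀ i, innerAN (r • (a • B + X)) (W i) = 0 := fun i => by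
    rw [innerAN_smul_left, innerAN_add_left, innerAN_smul_left, hBW, hXW]
    ring
  have hTT : innerAN (r • (a • B + X)) (r • (a • B + X)) = 1 := by
    simp only [innerAN_smul_left, innerAN_smul_right, innerAN_add_left, innerAN_add_right, hBX, hB1,
      innerAN_comm X B]
    linear_combination hr
  let A : Option (Option (Fin (Module.finrank ℝ w))) → su n :=
    fun o => o.elim (r • (a • B + X)) fun o => o.elim Z W
  refine orbitHasMeanCurvature_of_orthonormal A ?_ ?_ ?_ ?_
  · rw [h𝔥, Option.range_eq, Submodule.span_insert]
    change Submodule.span ℝ {r • (a • B + X)} ⊔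
      Submodule.span ℝ (Set.range fun o : Option _ => o.elim Z W) = _
    rw [Option.range_eq, Submodule.span_insert, Submodule.span_singleton_smul_eq (IsUnit.mk0 r hr0),
      rootSpace_one_eq_span hB hB1 hZ hZt, sup_assoc, sup_comm w]
    change _ ⊔ (_ ⊔ Submodule.span ℝ (Set.range W)) = _
    rw [hWspan]
    rfl
  · rintro (_ | _ | i) (_ | _ | j)
    · simpa [A] using hTT
    · simpa [A] using hTZ
    · simpa [A] using hTW j
    · simpa [A, innerAN_comm Z] using hTZ
    · simpa [A] using innerAN_one_self hB1 hZt
    · simpa [A] using hWZ j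
    · simpa [A, innerAN_comm (W i)] using hTW i
    · simpa [A, innerAN_comm (W i)] using hWZ i
    · simpa [A] using hW i j
  · have hsub : ∀ Y, innerAN (innerAN X X • B - a • X) Y =
        innerAN X X * innerAN B Y - a * innerAN X Y := fun Y => by
      rw [sub_eq_add_neg, ← neg_smul, innerAN_add_left, innerAN_smul_left, innerAN_smul_left]
      ring
    rintro (_ | _ | i)
    · simp only [A, Option.elim_none]
      rw [innerAN_smul_left, hsub]
      simp only [innerAN_smul_right, innerAN_add_right, hBX, hB1, innerAN_comm X B]
      ring
    · simp only [A, Option.elim_none, Option.elim_some]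
      rw [innerAN_smul_left, hsub, hBZ, innerAN_comm X Z, hZX]
      ring
    · simp only [A, Option.elim_some]
      rw [innerAN_smul_left, hsub, hBW, hXW]
      ring
  · intro ν hν
    have hs : ∀ i, metric 0 (acceleration (W i).1) ν = 1 / 2 * metric 0 (tangent B.1) ν := fun i =>
      metric_acceleration_of_unit hB hB1 (hw (hWw i)) (by simp [hW]) ν
    have hT : metric 0 (acceleration (r • (a • B + X)).1) ν =
        r ^ 2 * (innerAN X X / 2 * metric 0 (tangent B.1) ν - a / 2 * metric 0 (tangent X.1) ν) := by
      rw [smul_add, smul_smul, metric_acceleration_half hB hB1 _ (Submodule.smul_mem _ r hX),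
        innerAN_smul_left, innerAN_smul_right, SetLike.val_smul, map_smul, metric_smul_left]
      ring
    have h0 : a * metric 0 (tangent B.1) ν + metric 0 (tangent X.1) ν = 0 := by
      have h := hν none
      simp only [A, Option.elim_none, SetLike.val_smul, AddMemClass.coe_add, map_smul, map_add,
        metric_smul_left, metric_add_left] at h
      exact (mul_eq_zero.1 h).resolve_left hr0
    have hη : metric 0 (tangent (((3 + Module.finrank ℝ w : ℝ) / (2 * (a ^ 2 + innerAN X X))) •
        (innerAN X X • B - a • X) : su n).1) ν =
        (3 + Module.finrank ℝ w : ℝ) / (2 * (a ^ 2 + innerAN X X)) *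
          (innerAN X X * metric 0 (tangent B.1) ν - a * metric 0 (tangent X.1) ν) := by
      rw [sub_eq_add_neg, ← neg_smul]
      simp only [SetLike.val_smul, AddMemClass.coe_add, map_smul, map_add, metric_smul_left,
        metric_add_left]
      ring
    -- Normality of `ν` to `aB + X` turns every term into a multiple of `⟨B, ν⟩`: the sum is `1/2 +
    -- 1 + dim w / 2` from `aB + X`, `Z` and `w`.
    have hX' : metric 0 (tangent X.1) ν = -(a * metric 0 (tangent B.1) ν) := by linarith
    rw [hη, Fintype.sum_option, Fintype.sum_option]
    simp only [A, Option.elim_none, Option.elim_some, hs, acceleration_one hB hB1 hZ hZt, hT,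
      Finset.sum_const, Finset.card_univ, Fintype.card_fin, nsmul_eq_mul, hX']
    have hr' : r ^ 2 = 1 / (a ^ 2 + innerAN X X) := by
      rw [eq_div_iff hN.ne', hr]
    rw [hr']
    field_simp
    ring

end MeanCurvature

end ComplexHyperbolic

end

open ComplexHyperbolic in
/-- `B` is a unit vector of `𝔞 = ℝB ⊆ 𝔭`, and `α` is the restricted root with `α(B) = 1/2`, so that
`𝔤_α = rootSpace B (1/2)` and `𝔤_{2α} = rootSpace B 1`. -/
theorem mainTheorem11 (n : ℕ) (B : su n) (hB : B ∈ cartanP n) (hB1 : innerAN B B = 1)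
    (w : Submodule ℝ (su n)) (hw : w ≤ rootSpace B (1 / 2)) :
    (∀ (a : ℝ) (X : su n), a ≠ 0 → X ≠ 0 → X ∈ rootSpace B (1 / 2) →
      (∀ W ∈ w, innerAN X W = 0) →
      ∃ 𝔥 : LieSubalgebra ℝ (su n),
        𝔥.toSubmodule = Submodule.span ℝ {a • B + X} ⊔ w ⊔ rootSpace B 1 ∧
        OrbitHasMeanCurvature 𝔥
          (((3 + Module.finrank ℝ w : ℝ) / (2 * (a ^ 2 + innerAN X X))) •
            (innerAN X X • B - a • X))) ∧
    (∃ 𝔥 : LieSubalgebra ℝ (su n),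
      𝔥.toSubmodule = Submodule.span ℝ {B} ⊔ w ⊔ rootSpace B 1 ∧
      OrbitHasMeanCurvature 𝔥 0) ∧
    (∃ 𝔥 : LieSubalgebra ℝ (su n),
      𝔥.toSubmodule = w ⊔ rootSpace B 1 ∧
      OrbitHasMeanCurvature 𝔥 (((2 + Module.finrank ℝ w : ℝ) / 2) • B)) := by
  refine ⟨fun a X ha _ hX hXw => ?_, ?_, ?_⟩
  · obtain ⟨𝔥, h𝔥⟩ := exists_lieSubalgebra hB hB1 hw a hX
    exact ⟨𝔥, h𝔥, orbitHasMeanCurvature_solvable hB hB1 hw ha hX hXw h𝔥⟩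
  -- The case `𝔟 = 𝔞` is `a = 1`, `X = 0`, where `‖X‖² B - aX` vanishes.
  · obtain ⟨𝔥, h𝔥⟩ := exists_lieSubalgebra hB hB1 hw 1 (Submodule.zero_mem _)
    have h := orbitHasMeanCurvature_solvable hB hB1 hw one_ne_zero (Submodule.zero_mem _)
      (fun W _ => innerAN_zero_left W) h𝔥
    refine ⟨𝔥, by simpa using h𝔥, ?_⟩
    simpa [innerAN_zero_left] using h
  -- For `𝔟 = 0` take `a = 0`, `X = 0`: the first summand is the span of 0. The curvature needs its
  -- own computation, since the basis has one vector fewer.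
  · obtain ⟨𝔥, h𝔥⟩ := exists_lieSubalgebra hB hB1 hw 0 (Submodule.zero_mem _)
    have h' : 𝔥.toSubmodule = w ⊔ rootSpace B 1 := by simpa using h𝔥
    exact ⟨𝔥, h', orbitHasMeanCurvature_nilpotent hB hB1 hw h'⟩
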